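/- Let $n,p\ge 0$ be integers, $\theta\in\mathbb{R}^p$, and let $\Sigma$ be a symmetric positive definite $p\times p$ real matrix. Let $X\sim\mathcal N_p(\theta,\Sigma)$ and $Y\sim\mathcal N_{n\times p}(0,I_n\otimes\Sigma)$ be independent, the latter meaning that $Y$ is a random $n\times p$ matrix with $\mathrm{vec}(Y^\top)\sim\mathcal N_{np}(0,I_n\otimes\Sigma)$ (the rows of $Y$ are i.i.d. $\mathcal N_p(0,\Sigma)$). Let $A=\Sigma^{1/2}$ be the symmetric positive definite square root of $\Sigma$, $\tilde Y=YA^{-1}$, $S=Y^\top Y$, $R=\mathrm{rank}(S)$, let $S^+$ be the Moore–Penrose inverse of $S$, and let $F=X^\top S^+X$. Let $r:\mathbb{R}\to[0,C_1]$ be differentiable with $|r'|\le C_2$, where $C_1,C_2$ are real constants. Define $$G=\frac{r^2(F)}{F^2}\,S^+XX^\top S^+S,\qquad H=AGA^{-1}.$$ For fixed $X$, regard $H$ as a function of $\tilde Y$ through $S=A\tilde Y^\top\tilde YA$, and let $$\mathrm{div}_{\mathrm{vec}(\tilde Y)}\mathrm{vec}(\tilde YH)=\sum_{i=1}^n\sum_{j=1}^p\frac{\partial(\tilde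 YH)_{ij}}{\partial\tilde Y_{ij}}.$$ Theorem. If $P(R>2)=1$, then almost surely the map $\mathrm{vec}(\tilde Y)\mapsto\mathrm{vec}(\tilde YH)$ is differentiable at $\mathrm{vec}(\tilde Y)$ (so that the divergence is defined), and $$\mathrm{E}\left[\left|\mathrm{div}_{\mathrm{vec}(\tilde Y)}\mathrm{vec}(\tilde YH)\right|\right]<\infty .$$ -/

import Mathlib

open MeasureTheory ProbabilityTheory Matrix
open scoped Kronecker MatrixOrder

/-- The four Penrose equations: `B` is a Moore–Penrose inverse of the real matrix `M`. -/
structure IsMoorePenrose {m n : Type*} [Fintype m] [Fintype n]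
    (M : Matrix m n ℝ) (B : Matrix n m ℝ) : Prop where
  mul_mul_self : M * B * M = M
  mul_mul_inv : B * M * B = B
  symm_left : (M * B)ᵀ = M * B
  symm_right : (B * M)ᵀ = B * M

theorem IsMoorePenrose.unique {m n : Type*} [Fintype m] [Fintype n]
    {M : Matrix m n ℝ} {B C : Matrix n m ℝ}
    (hB : IsMoorePenrose M B) (hC : IsMoorePenrose M C) : B = C := by
  have h1 : M * B = M * C := by
    calc M * B = (M * C * M) * B := by rw [hC.mul_mul_self]
      _ = (M * C)ᵀ * (M * B)ᵀ := by
          rw [hC.symm_left, hB.symm_left]; simp only [Matrix.mul_assoc]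
      _ = (M * B * M * C)ᵀ := by
          rw [← Matrix.transpose_mul]; simp only [Matrix.mul_assoc]
      _ = M * C := by rw [hB.mul_mul_self, hC.symm_left]
  have h2 : B * M = C * M := by
    calc B * M = B * (M * C * M) := by rw [hC.mul_mul_self]
      _ = (B * M)ᵀ * (C * M)ᵀ := by
          rw [hC.symm_right, hB.symm_right]; simp only [Matrix.mul_assoc]
      _ = (C * (M * B * M))ᵀ := by
          rw [← Matrix.transpose_mul]; simp only [Matrix.mul_assoc]
      _ = C * M := by rw [hB.mul_mul_self, hC.symm_right]
  calc B = B * M * B := hB.mul_mul_inv.symm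
    _ = C * (M * B) := by rw [h2, Matrix.mul_assoc]
    _ = C * M * C := by rw [h1, Matrix.mul_assoc]
    _ = C := hC.mul_mul_inv

theorem exists_isMoorePenrose_of_isHermitian {n : Type*} [Fintype n] [DecidableEq n]
    {B : Matrix n n ℝ} (hB : B.IsHermitian) :
    ∃ P : Matrix n n ℝ, IsMoorePenrose B P ∧ Pᵀ = P := by
  set U : Matrix n n ℝ := (hB.eigenvectorUnitary : Matrix n n ℝ) with hU
  set d : n → ℝ := hB.eigenvalues with hd
  have hUU : Uᵀ * U = 1 := by
    have := Unitary.coe_star_mul_self hB.eigenvectorUnitary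
    simpa [Matrix.star_eq_conjTranspose] using this
  have hspec : B = U * diagonal d * Uᵀ := by
    have h := hB.spectral_theorem
    rw [Unitary.conjStarAlgAut_apply] at h
    simpa [Matrix.star_eq_conjTranspose, Function.comp_def] using h
  have key : ∀ a b : n → ℝ,
      (U * diagonal a * Uᵀ) * (U * diagonal b * Uᵀ) = U * diagonal (fun i => a i * b i) * Uᵀ := by
    intro a b
    calc (U * diagonal a * Uᵀ) * (U * diagonal b * Uᵀ)
        = U * diagonal a * (Uᵀ * U) * diagonal b * Uᵀ := by simp only [Matrix.mul_assoc]
      _ = _ := by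
        rw [hUU, Matrix.mul_one, Matrix.mul_assoc U, Matrix.diagonal_mul_diagonal]
  have ksymm : ∀ a : n → ℝ, (U * diagonal a * Uᵀ)ᵀ = U * diagonal a * Uᵀ := by
    intro a
    simp [Matrix.transpose_mul, Matrix.mul_assoc]
  refine ⟨U * diagonal (fun i => (d i)⁻¹) * Uᵀ, ⟨?_, ?_, ?_, ?_⟩, ksymm _⟩
  · rw [hspec, key, key]
    congr 3; funext i
    by_cases h : d i = 0 <;> simp [h]
  · rw [hspec, key, key]
    congr 3; funext i
    by_cases h : d i = 0 <;> simp [h]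
  · rw [hspec, key, ksymm]
  · rw [hspec, key, ksymm]

theorem exists_isMoorePenrose {m n : Type*} [Fintype m] [Fintype n]
    (M : Matrix m n ℝ) : ∃ B : Matrix n m ℝ, IsMoorePenrose M B := by
  classical
  have hH : (Mᵀ * M).IsHermitian := by
    simpa using Matrix.isHermitian_conjTranspose_mul_self M
  obtain ⟨P, hP, hPs⟩ := exists_isMoorePenrose_of_isHermitian hH
  have h0 : M * P * (Mᵀ * M) - M = 0 := by
    rw [← Matrix.conjTranspose_mul_self_eq_zero, Matrix.conjTranspose_eq_transpose_of_trivial]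
    have e : Mᵀ * (M * P * (Mᵀ * M) - M) = 0 := by
      rw [Matrix.mul_sub, sub_eq_zero]
      have := hP.mul_mul_self
      simpa only [Matrix.mul_assoc] using this
    have e2 : (M * P * (Mᵀ * M) - M)ᵀ = (Mᵀ * M * P - 1) * Mᵀ := by
      simp [Matrix.transpose_mul, hPs, Matrix.mul_assoc, Matrix.sub_mul]
    rw [e2, Matrix.mul_assoc, e, Matrix.mul_zero]
  refine ⟨P * Mᵀ, ⟨?_, ?_, ?_, ?_⟩⟩
  · have := sub_eq_zero.mp h0
    simpa only [Matrix.mul_assoc] using this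
  · have := congrArg (· * Mᵀ) hP.mul_mul_inv
    simpa only [Matrix.mul_assoc] using this
  · simp [Matrix.transpose_mul, hPs, Matrix.mul_assoc]
  · have := hP.symm_right
    simpa only [Matrix.mul_assoc] using this

/-- The Moore–Penrose inverse `M⁺`: the unique solution of the Penrose equations. -/
noncomputable def pinv {m n : Type*} [Fintype m] [Fintype n] (M : Matrix m n ℝ) :
    Matrix n m ℝ :=
  Classical.choose (exists_isMoorePenrose M)

theorem isMoorePenrose_pinv {m n : Type*} [Fintype m] [Fintype n] (M : Matrix m n ℝ) :
    IsMoorePenrose M (pinv M) :=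
  Classical.choose_spec (exists_isMoorePenrose M)

/-- The statistic `F = xᵀ S⁺ x`. -/
noncomputable def statF {p : ℕ} (x : Fin p → ℝ) (S : Matrix (Fin p) (Fin p) ℝ) : ℝ :=
  x ⬝ᵥ (pinv S *ᵥ x)

/-- The matrix `G = (r(F)² / F²) S⁺ x xᵀ S⁺ S`. -/
noncomputable def matG {p : ℕ} (r : ℝ → ℝ) (x : Fin p → ℝ)
    (S : Matrix (Fin p) (Fin p) ℝ) : Matrix (Fin p) (Fin p) ℝ :=
  (r (statF x S) ^ 2 / statF x S ^ 2) • (pinv S * vecMulVec x x * pinv S * S)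

/-- The matrix `H = A G A⁻¹`, as a function of `Z` (the value of `Ỹ = Y A⁻¹`):
here `Y = Z A` and `S = Yᵀ Y = (Z A)ᵀ (Z A)`. -/
noncomputable def matH {n p : ℕ} (r : ℝ → ℝ) (A : Matrix (Fin p) (Fin p) ℝ) (x : Fin p → ℝ)
    (Z : Matrix (Fin n) (Fin p) ℝ) : Matrix (Fin p) (Fin p) ℝ :=
  A * matG r x ((Z * A)ᵀ * (Z * A)) * A⁻¹

/-- The inverse of the vectorization `Matrix.vec` (stacking of columns). -/
def unvec {n p : ℕ} (v : Fin p × Fin n → ℝ) : Matrix (Fin n) (Fin p) ℝ :=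
  Matrix.of fun i j => v (j, i)

/-- The vector field `vec Z ↦ vec (Z H)` on `ℝ^(np)`, where `H` depends on `Z`
and `x` is held fixed. -/
noncomputable def vecField {n p : ℕ} (r : ℝ → ℝ) (A : Matrix (Fin p) (Fin p) ℝ)
    (x : Fin p → ℝ) (v : Fin p × Fin n → ℝ) : Fin p × Fin n → ℝ :=
  vec (unvec v * matH r A x (unvec v))

/-- The divergence `∑ₖ ∂gₖ/∂vₖ` of a vector field `g` at a point of differentiability `v`. -/
noncomputable def divergence {ι : Type*} [Fintype ι] [DecidableEq ι]
    (g : (ι → ℝ) → (ι → ℝ)) (v : ι → ℝ) : ℝ :=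
  ∑ k, fderiv ℝ g v (Pi.single k 1) k

/-! Put `Z = Y A⁻¹` and `u = (Y⁺)ᵀ x`. Since `S⁺ = Y⁺ (Y⁺)ᵀ`, one gets `F = u·u`, and the field is
the rank one matrix `Z H = φ(F) u (uᵀ Z)` with `φ(t) = r(t)² / t²` (`mul_matH`).

Gaussian `Y` almost surely has full rank `m = min(n, p)`. Near such a point `Y⁺` is a rational
function of `Y`. Differentiating the normal equations satisfied by `u` gives exactly those traces of
`du` that enter the divergence, and `div = (n + p - 2m + 3) r(F)² / F - 4 r(F) r'(F)`
(`HasPinvTraces.divergence_vecField`). As `r` and `r'` are bounded, it remains to prove `E[1/F] <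
∞`.

Write `X = A h`, where `h` is Gaussian with identity covariance. For fixed `Y` of rank at least 3
there are orthonormal `q₁, q₂, q₃` with `∑ ⟨qᵢ, h⟩² ≤ ‖Z‖² F`, in the Frobenius norm
(`exists_orthonormal_sum_inner_sq_le_mul_statF`). The three coordinates are independent Gaussians of
variance one, and the inverse of their sum of squares has expectation bounded uniformly in the `qᵢ`
and in the mean (`exists_lintegral_inv_sum_sq_inner_stdGaussian_le`). So `E[1/F | Y] ≤ K (‖Z‖² +
1)`, which is integrable in `Y`. -/

/-! ### Gaussian null sets -/

/-- The determinant is a polynomial in `t` whose coefficient in degree `card m` is `det B`, so it is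
not the zero polynomial. -/
theorem Matrix.finite_setOf_det_add_smul_eq_zero {m : Type*} [Fintype m] [DecidableEq m]
    (A B : Matrix m m ℝ) (hB : B.det ≠ 0) : {t : ℝ | (A + t • B).det = 0}.Finite := by
  set q : Polynomial ℝ :=
    det ((Polynomial.X : Polynomial ℝ) • B.map Polynomial.C + A.map Polynomial.C) with hq
  have hq0 : q ≠ 0 := by
    intro h
    apply hB
    rw [← Polynomial.coeff_det_X_add_C_card B A, ← hq, h, Polynomial.coeff_zero]
  refine (q.roots.toFinset.finite_toSet).subset fun t ht => ?_
  have : q.eval t = (A + t • B).det := by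
    rw [hq, ← Polynomial.coe_evalRingHom, RingHom.map_det]
    congr 1
    ext i j
    simp
    ring
  simpa [hq0, this] using ht

/-- In an orthonormal basis starting with `v`, the coordinate along `v` is independent of the others
and has no atoms. Fubini then integrates the measure of finite slices, which is zero. -/
theorem ProbabilityTheory.stdGaussian_eq_zero_of_finite_lines {E : Type*} [NormedAddCommGroup E]
    [InnerProductSpace ℝ E] [FiniteDimensional ℝ E] [MeasurableSpace E] [BorelSpace E]
    {s : Set E} (hs : MeasurableSet s) {v : E}
    (hv : ‖v‖ = 1) (hfin : ∀ a : E, {t : ℝ | a + t • v ∈ s}.Finite) : stdGaussian E s = 0 := by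
  have hv0 : v ≠ 0 := by
    rintro rfl
    simp at hv
  have : Nontrivial E := ⟨⟨v, 0, hv0⟩⟩
  obtain ⟨k, hk⟩ : ∃ k, Module.finrank ℝ E = k + 1 :=
    Nat.exists_eq_succ_of_ne_zero (Module.finrank_pos (R := ℝ) (M := E)).ne'
  obtain ⟨b, hb⟩ := Orthonormal.exists_orthonormalBasis_extension_of_card_eq (𝕜 := ℝ) (E := E)
    (ι := Fin (k + 1)) (by simpa using hk) (v := fun _ => v) (s := {0}) (by
      rw [orthonormal_iff_ite]
      intro i j
      have : i = j := Subsingleton.elim _ _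
      simp [this, hv])
  have hb0 : b 0 = v := hb 0 rfl
  have hmeas : Measurable fun x : Fin (k + 1) → ℝ => ∑ i, x i • b i := by fun_prop
  rw [stdGaussian_eq_map_pi_orthonormalBasis b, Measure.map_apply hmeas hs]
  have hmp := measurePreserving_piFinSuccAbove (fun _ : Fin (k + 1) => gaussianReal 0 1) 0
  rw [← hmp.symm.map_eq, Measure.map_apply (MeasurableEquiv.measurable _) (hmeas hs)]
  rw [← Measure.prod_swap, Measure.map_apply measurable_swap
    ((MeasurableEquiv.measurable _) (hmeas hs)), Measure.measure_prod_null
    (measurable_swap ((MeasurableEquiv.measurable _) (hmeas hs)))]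
  refine Filter.Eventually.of_forall fun y => ?_
  have : NullSingletonClass (gaussianReal 0 1) := nullSingletonClass_gaussianReal one_ne_zero
  refine Set.Finite.measure_zero ((hfin (∑ i, y i • b (Fin.succ i))).subset fun t ht => ?_) _
  simp only [Set.mem_preimage, Prod.swap_prod_mk, MeasurableEquiv.piFinSuccAbove_symm_apply,
    Fin.sum_univ_succ, hb0] at ht
  simpa [Fin.insertNthEquiv, add_comm] using ht

theorem ProbabilityTheory.ae_det_ne_zero_multivariateGaussian {ι m : Type*} [Fintype ι]
    [DecidableEq ι] [Fintype m] [DecidableEq m] {S : Matrix ι ι ℝ} (hS : S.PosDef)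
    (L : EuclideanSpace ℝ ι →ₗ[ℝ] Matrix m m ℝ) {w : EuclideanSpace ℝ ι} (hw : (L w).det ≠ 0) :
    ∀ᵐ y ∂multivariateGaussian 0 S, (L y).det ≠ 0 := by
  have hLc : Continuous fun y => (L y).det :=
    Continuous.matrix_det L.continuous_of_finiteDimensional
  have hLm : MeasurableSet {y | (L y).det ≠ 0} :=
    (isOpen_ne_fun hLc continuous_const).measurableSet
  have hT : Measurable fun x : EuclideanSpace ℝ ι =>
      (0 : EuclideanSpace ℝ ι) + toEuclideanCLM (𝕜 := ℝ) (CFC.sqrt S) x := by fun_prop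
  rw [multivariateGaussian, ae_map_iff hT.aemeasurable hLm]
  set T : EuclideanSpace ℝ ι →L[ℝ] EuclideanSpace ℝ ι := toEuclideanCLM (𝕜 := ℝ) (CFC.sqrt S)
    with hTdef
  simp only [zero_add]
  -- An empty determinant is 1. Otherwise `det (L w) ≠ 0` forces `w ≠ 0`, which supplies a direction
  -- for the lines.
  by_cases hm : IsEmpty m
  · simp
  have hu : IsUnit (CFC.sqrt S) := (CFC.isUnit_sqrt_iff S hS.posSemidef.nonneg).2 hS.isUnit
  obtain ⟨w', hw'⟩ : ∃ w', T w' = w := by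
    obtain ⟨B, hB⟩ := hu.exists_right_inv
    refine ⟨toEuclideanCLM (𝕜 := ℝ) B w, ?_⟩
    rw [hTdef, ← mul_apply_eq_comp, ← map_mul, hB, map_one,
      one_apply_eq_self]
  have hw0 : w' ≠ 0 := by
    rintro rfl
    have : Nonempty m := not_isEmpty_iff.1 hm
    apply hw
    rw [← hw', map_zero, map_zero, det_zero]
  rw [ae_iff]
  refine stdGaussian_eq_zero_of_finite_lines (v := ‖w'‖⁻¹ • w') ?_ (norm_smul_inv_norm hw0)
    fun a => ?_
  · simp only [ne_eq, not_not]
    exact (isClosed_eq (hLc.comp T.continuous) continuous_const).measurableSet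
  · have h := finite_setOf_det_add_smul_eq_zero (L (T a)) (L (T (‖w'‖⁻¹ • w'))) (by
      rw [map_smul, map_smul, hw', det_smul]
      exact mul_ne_zero (pow_ne_zero _ (inv_ne_zero (norm_ne_zero_iff.2 hw0))) hw)
    simpa using h

/-! ### Uniform bounds for negative moments of Gaussian vectors -/

/-- Where `|t + a| > 1` the integrand is at most 1. On the remaining interval the Gaussian density
is at most 1, and translation invariance of Lebesgue measure removes `a`, leaving `|t|^s` on `[-1,
1]`, integrable because `s > -1`. -/
theorem ProbabilityTheory.exists_lintegral_enorm_rpow_gaussianReal_le {s : ℝ} (hs0 : s < 0)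
    (hs : -1 < s) :
    ∃ K : ENNReal, K ≠ ⊤ ∧ ∀ a : ℝ, ∫⁻ t, ‖t + a‖ₑ ^ s ∂gaussianReal 0 1 ≤ K := by
  have hI : ∫⁻ t in Set.Icc (-1 : ℝ) 1, ‖t‖ₑ ^ s ≠ ⊤ := by
    have h1 : IntervalIntegrable (fun t : ℝ => |t| ^ s) volume (-1) 1 := by
      refine IntervalIntegrable.trans (b := 0) ?_ ?_
      · have := (intervalIntegral.intervalIntegrable_rpow' (a := 0) (b := 1) hs).comp_sub_left 0
        refine IntervalIntegrable.congr ?_ (by simpa using this.symm)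
        intro t ht
        rw [Set.uIoc_of_le (by norm_num)] at ht
        simp [abs_of_nonpos ht.2]
      · refine (intervalIntegral.intervalIntegrable_rpow' (a := 0) (b := 1) hs).congr ?_
        intro t ht
        rw [Set.uIoc_of_le (by norm_num)] at ht
        simp [abs_of_pos ht.1]
    rw [intervalIntegrable_iff_integrableOn_Icc_of_le (by norm_num)] at h1
    have h2 := h1.hasFiniteIntegral
    rw [HasFiniteIntegral] at h2
    refine ne_of_lt (lt_of_le_of_lt (lintegral_mono_ae ?_) h2)
    -- At `t = 0` the extended power is `⊤` while the real power is 0, so the comparison holds only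
    -- almost everywhere.
    filter_upwards [(volume.restrict (Set.Icc (-1 : ℝ) 1)).ae_ne 0] with t ht
    rw [← ofReal_norm, ← ofReal_norm,
      ENNReal.ofReal_rpow_of_pos (norm_pos_iff.2 ht)]
    refine ENNReal.ofReal_le_ofReal ?_
    rw [Real.norm_eq_abs, Real.norm_eq_abs]
    exact le_abs_self _
  refine ⟨1 + ∫⁻ t in Set.Icc (-1 : ℝ) 1, ‖t‖ₑ ^ s, by simp [hI], fun a => ?_⟩
  set I : Set ℝ := {t | t + a ∈ Set.Icc (-1 : ℝ) 1} with hIdef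
  have hIm : MeasurableSet I := measurableSet_Icc.preimage (measurable_id.add_const a)
  rw [← lintegral_add_compl _ hIm, add_comm]
  refine add_le_add ?_ ?_
  · calc ∫⁻ t in Iᶜ, ‖t + a‖ₑ ^ s ∂gaussianReal 0 1
        ≤ ∫⁻ t in Iᶜ, 1 ∂gaussianReal 0 1 := by
          refine setLIntegral_mono measurable_const fun t ht => ?_
          refine ENNReal.rpow_le_one_of_one_le_of_neg ?_ hs0
          have h1 : 1 ≤ ‖t + a‖ := by
            rw [Real.norm_eq_abs]
            by_contra h
            exact ht (abs_le.1 (not_le.1 h).le)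
          rw [← ofReal_norm]
          simpa using ENNReal.ofReal_le_ofReal h1
      _ ≤ 1 := by
          rw [setLIntegral_const, one_mul]
          exact prob_le_one
  · have hle : gaussianReal 0 1 ≤ volume := by
      rw [gaussianReal_of_var_ne_zero _ one_ne_zero]
      refine (withDensity_mono (g := 1) (Filter.Eventually.of_forall fun t => ?_)).trans
        (by rw [withDensity_one])
      rw [gaussianPDF, Pi.one_apply, ← ENNReal.ofReal_one]
      refine ENNReal.ofReal_le_ofReal ?_
      rw [gaussianPDFReal]
      refine mul_le_one₀ ?_ (Real.exp_nonneg _) ?_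
      · refine inv_le_one_of_one_le₀ ?_
        rw [Real.one_le_sqrt]
        have := Real.pi_gt_three
        simp only [NNReal.coe_one, mul_one]
        linarith
      · rw [Real.exp_le_one_iff]
        have : 0 ≤ (t - 0) ^ 2 / (2 * ((1 : NNReal) : ℝ)) := by positivity
        rw [neg_div]
        linarith
    calc ∫⁻ t in I, ‖t + a‖ₑ ^ s ∂gaussianReal 0 1
        ≤ ∫⁻ t in I, ‖t + a‖ₑ ^ s := lintegral_mono' (Measure.restrict_mono le_rfl hle) le_rfl
      _ = ∫⁻ t in Set.Icc (-1 : ℝ) 1, ‖t‖ₑ ^ s := by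
          have := (measurePreserving_add_right (volume : Measure ℝ) a).setLIntegral_comp_preimage
            (measurableSet_Icc (a := (-1 : ℝ)) (b := 1)) (f := fun t => ‖t‖ₑ ^ s)
            (by fun_prop)
          exact this

/-- Each `xᵢ²` is at most the sum, so each factor is at least the sum to the power `-1/d`, and there
are `d` factors. A product of functions of single coordinates factors under independence. -/
theorem ENNReal.inv_sum_sq_le_prod_rpow {ι : Type*} [Fintype ι] (x : ι → ENNReal)
    {d : ℕ} (hd : Fintype.card ι = d) (hd0 : d ≠ 0) :
    (∑ i, x i ^ 2)⁻¹ ≤ ∏ i, x i ^ (-(2 / d : ℝ)) := by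
  have hd' : (d : ℝ) ≠ 0 := by exact_mod_cast hd0
  set s := ∑ i, x i ^ 2 with hs
  have h1 : s⁻¹ = ∏ _i : ι, s ^ (-(1 / d : ℝ)) := by
    rw [Finset.prod_const, Finset.card_univ, hd, ← ENNReal.rpow_natCast, ← ENNReal.rpow_mul,
      ← ENNReal.rpow_neg_one]
    congr 1
    field_simp
  rw [h1]
  refine Finset.prod_le_prod' fun i _ => ?_
  have h2 : x i ^ (-(2 / d : ℝ)) = (x i ^ 2) ^ (-(1 / d : ℝ)) := by
    rw [← ENNReal.rpow_natCast, ← ENNReal.rpow_mul]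
    congr 1
    push_cast
    ring
  rw [h2]
  rw [ENNReal.rpow_neg, ENNReal.rpow_neg, ENNReal.inv_le_inv]
  refine ENNReal.rpow_le_rpow ?_ (by positivity)
  exact Finset.single_le_sum (f := fun i => x i ^ 2) (fun _ _ => zero_le) (Finset.mem_univ i)

/-- Three directions give the exponent `-2/3 > -1` in each coordinate; two would give `-1`, which is
not integrable. This is the role of rank greater than 2. -/
theorem ProbabilityTheory.exists_lintegral_inv_sum_sq_inner_stdGaussian_le (E : Type*)
    [NormedAddCommGroup E] [InnerProductSpace ℝ E] [FiniteDimensional ℝ E] [MeasurableSpace E]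
    [BorelSpace E] :
    ∃ K : ENNReal, K ≠ ⊤ ∧ ∀ q : Fin 3 → E, Orthonormal ℝ q → ∀ a : E,
      ∫⁻ g, (∑ i, ‖inner ℝ (q i) (g + a)‖ₑ ^ 2)⁻¹ ∂stdGaussian E ≤ K := by
  obtain ⟨K, hK, h⟩ := exists_lintegral_enorm_rpow_gaussianReal_le (s := -(2 / (3 : ℕ) : ℝ))
    (by norm_num) (by norm_num)
  refine ⟨K ^ 3, by simp [hK], fun q hq a => ?_⟩
  have hcard : 3 ≤ Module.finrank ℝ E := by
    simpa using hq.linearIndependent.fintype_card_le_finrank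
  set e : Fin 3 ↪ Fin (Module.finrank ℝ E) := Fin.castLEEmb hcard with he
  obtain ⟨b, hb⟩ := Orthonormal.exists_orthonormalBasis_extension_of_card_eq (𝕜 := ℝ) (E := E)
    (ι := Fin (Module.finrank ℝ E)) (by simp)
    (v := fun j => if hj : (j : ℕ) < 3 then q ⟨j, hj⟩ else 0) (s := Set.range e) (by
      rw [orthonormal_iff_ite] at hq ⊢
      rintro ⟨_, i, rfl⟩ ⟨_, j, rfl⟩
      simpa [he, Set.domRestrict] using hq i j)
  have hbq : ∀ i, b (e i) = q i := fun i => by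
    rw [hb (e i) ⟨i, rfl⟩]
    simp [he]
  have hF : Measurable fun g : E => (∑ i, ‖inner ℝ (q i) (g + a)‖ₑ ^ 2)⁻¹ := by fun_prop
  rw [stdGaussian_eq_map_pi_orthonormalBasis b, lintegral_map hF (by fun_prop)]
  have hin : ∀ (x : Fin (Module.finrank ℝ E) → ℝ) (i : Fin 3),
      inner ℝ (q i) ((∑ j, x j • b j) + a) = x (e i) + inner ℝ (q i) a := by
    intro x i
    rw [inner_add_right, ← hbq, b.orthonormal.inner_right_fintype]
  simp only [hin]
  have hX : ∀ i, Measurable fun x : Fin (Module.finrank ℝ E) → ℝ =>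
      ‖x (e i) + inner ℝ (q i) a‖ₑ ^ (-(2 / (3 : ℕ) : ℝ)) := by fun_prop
  have hind : iIndepFun (fun (i : Fin 3) (x : Fin (Module.finrank ℝ E) → ℝ) =>
      ‖x (e i) + inner ℝ (q i) a‖ₑ ^ (-(2 / (3 : ℕ) : ℝ)))
      (Measure.pi fun _ => gaussianReal 0 1) := by
    have h0 : iIndepFun (fun (i : Fin (Module.finrank ℝ E))
        (x : Fin (Module.finrank ℝ E) → ℝ) => x i) (Measure.pi fun _ => gaussianReal 0 1) :=
      iIndepFun_pi (X := fun _ t => t) fun _ => aemeasurable_id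
    exact (h0.precomp e.injective).comp
      (fun i t => ‖t + inner ℝ (q i) a‖ₑ ^ (-(2 / (3 : ℕ) : ℝ))) fun i => by fun_prop
  calc ∫⁻ x, (∑ i, ‖x (e i) + inner ℝ (q i) a‖ₑ ^ 2)⁻¹ ∂(Measure.pi fun _ => gaussianReal 0 1)
      ≤ ∫⁻ x, ∏ i, ‖x (e i) + inner ℝ (q i) a‖ₑ ^ (-(2 / (3 : ℕ) : ℝ))
          ∂(Measure.pi fun _ => gaussianReal 0 1) :=
        lintegral_mono fun x => ENNReal.inv_sum_sq_le_prod_rpow _ (by simp)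
          (by norm_num)
    _ = ∏ i : Fin 3, ∫⁻ x, ‖x (e i) + inner ℝ (q i) a‖ₑ ^ (-(2 / (3 : ℕ) : ℝ))
          ∂(Measure.pi fun _ => gaussianReal 0 1) :=
        lintegral_prod_eq_prod_lintegral_of_indepFun _ _ hind hX
    _ ≤ ∏ _i : Fin 3, K := by
        refine Finset.prod_le_prod' fun i _ => ?_
        have hmp := measurePreserving_eval
          (fun _ : Fin (Module.finrank ℝ E) => gaussianReal 0 1) (e i)
        refine le_trans (le_of_eq ?_) (h (inner ℝ (q i) a))
        rw [← hmp.lintegral_comp (by fun_prop)]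
    _ = K ^ 3 := by simp

/-! ### The Moore–Penrose inverse of a Gram matrix -/

theorem IsMoorePenrose.transpose_mul_self {m n : Type*} [Fintype m] [Fintype n]
    {M : Matrix m n ℝ} {B : Matrix n m ℝ} (h : IsMoorePenrose M B) :
    IsMoorePenrose (Mᵀ * M) (B * Bᵀ) := by
  have h1 : Bᵀ * (Mᵀ * M) = M := by
    rw [← Matrix.mul_assoc, ← transpose_mul, h.symm_left, h.mul_mul_self]
  have h2 : Mᵀ * M * B = Mᵀ := by
    have := congrArg transpose h1
    simpa using this
  have h3 : Mᵀ * M * (B * Bᵀ) = B * M := by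
    rw [← Matrix.mul_assoc, h2, ← transpose_mul, h.symm_right]
  have h4 : B * Bᵀ * (Mᵀ * M) = B * M := by rw [Matrix.mul_assoc, h1]
  refine ⟨?_, ?_, ?_, ?_⟩
  · have h5 : B * M * Mᵀ = Mᵀ := by
      rw [← h.symm_right, ← transpose_mul, ← Matrix.mul_assoc, h.mul_mul_self]
    rw [h3, ← Matrix.mul_assoc, h5]
  · rw [h4, ← Matrix.mul_assoc, h.mul_mul_inv]
  · rw [h3, h.symm_right]
  · rw [h4, h.symm_right]

theorem pinv_transpose_mul_self {m n : Type*} [Fintype m] [Fintype n] (M : Matrix m n ℝ) :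
    pinv (Mᵀ * M) = pinv M * (pinv M)ᵀ :=
  (isMoorePenrose_pinv _).unique (isMoorePenrose_pinv M).transpose_mul_self

theorem statF_transpose_mul_self {n p : ℕ} (x : Fin p → ℝ) (M : Matrix (Fin n) (Fin p) ℝ) :
    statF x (Mᵀ * M) = ((pinv M)ᵀ *ᵥ x) ⬝ᵥ ((pinv M)ᵀ *ᵥ x) := by
  rw [statF, pinv_transpose_mul_self, ← mulVec_mulVec, dotProduct_mulVec, mulVec_transpose]

/-- The matrix field `Z ↦ Z H` has rank one: it equals `(r(F)² / F²) u (uᵀ Z)`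
with `u = ((Z A)⁺)ᵀ x`. -/
theorem mul_matH {n p : ℕ} (r : ℝ → ℝ) {A : Matrix (Fin p) (Fin p) ℝ} (hA : IsUnit A.det)
    (x : Fin p → ℝ) (Z : Matrix (Fin n) (Fin p) ℝ) :
    Z * matH r A x Z = (r (((pinv (Z * A))ᵀ *ᵥ x) ⬝ᵥ ((pinv (Z * A))ᵀ *ᵥ x)) ^ 2 /
      (((pinv (Z * A))ᵀ *ᵥ x) ⬝ᵥ ((pinv (Z * A))ᵀ *ᵥ x)) ^ 2) •
      vecMulVec ((pinv (Z * A))ᵀ *ᵥ x) (((pinv (Z * A))ᵀ *ᵥ x) ᵥ* Z) := by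
  rw [matH, matG, statF_transpose_mul_self]
  rw [Matrix.mul_smul, Matrix.smul_mul, Matrix.mul_smul]
  congr 1
  rw [pinv_transpose_mul_self]
  set Y := Z * A with hY
  set B := pinv Y with hB
  have h := isMoorePenrose_pinv Y
  rw [← hB] at h
  have e1 : Y * (B * Bᵀ) = Bᵀ := by
    rw [← Matrix.mul_assoc, ← h.symm_left, ← transpose_mul, ← Matrix.mul_assoc, h.mul_mul_inv]
  have e2 : Bᵀ * (Yᵀ * Y) = Y := by
    rw [← Matrix.mul_assoc, ← transpose_mul, h.symm_left, h.mul_mul_self]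
  calc Z * (A * (B * Bᵀ * vecMulVec x x * (B * Bᵀ) * (Yᵀ * Y)) * A⁻¹)
      = Y * (B * Bᵀ) * vecMulVec x x * B * (Bᵀ * (Yᵀ * Y)) * A⁻¹ := by
        rw [hY]; simp only [Matrix.mul_assoc]
    _ = Bᵀ * vecMulVec x x * B * Z := by
        rw [e1, e2, hY, Matrix.mul_assoc _ (Z * A), Matrix.mul_assoc Z, Matrix.mul_nonsing_inv _ hA,
          Matrix.mul_one]
    _ = vecMulVec (Bᵀ *ᵥ x) ((Bᵀ *ᵥ x) ᵥ* Z) := by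
        rw [mul_vecMulVec, vecMulVec_mul, vecMulVec_mul, mulVec_transpose]

theorem isMoorePenrose_of_isUnit_transpose_mul_self {m n : Type*} [Fintype m] [Fintype n]
    [DecidableEq n] {M : Matrix m n ℝ} (h : IsUnit (Mᵀ * M).det) :
    IsMoorePenrose M ((Mᵀ * M)⁻¹ * Mᵀ) := by
  have h1 : (Mᵀ * M)⁻¹ * Mᵀ * M = 1 := by
    rw [Matrix.mul_assoc, Matrix.nonsing_inv_mul _ h]
  refine ⟨?_, ?_, ?_, ?_⟩
  · rw [Matrix.mul_assoc, h1, Matrix.mul_one]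
  · rw [h1, Matrix.one_mul]
  · simp [transpose_nonsing_inv, Matrix.mul_assoc]
  · rw [h1, transpose_one]

theorem isMoorePenrose_of_isUnit_self_mul_transpose {m n : Type*} [Fintype m] [Fintype n]
    [DecidableEq m] {M : Matrix m n ℝ} (h : IsUnit (M * Mᵀ).det) :
    IsMoorePenrose M (Mᵀ * (M * Mᵀ)⁻¹) := by
  have h1 : M * (Mᵀ * (M * Mᵀ)⁻¹) = 1 := by
    rw [← Matrix.mul_assoc, Matrix.mul_nonsing_inv _ h]
  refine ⟨?_, ?_, ?_, ?_⟩
  · rw [h1, Matrix.one_mul]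
  · rw [Matrix.mul_assoc, h1, Matrix.mul_one]
  · rw [h1, transpose_one]
  · simp [transpose_nonsing_inv, Matrix.mul_assoc]

theorem pinv_of_isUnit_transpose_mul_self {m n : Type*} [Fintype m] [Fintype n]
    [DecidableEq n] {M : Matrix m n ℝ} (h : IsUnit (Mᵀ * M).det) :
    pinv M = (Mᵀ * M)⁻¹ * Mᵀ :=
  (isMoorePenrose_pinv _).unique (isMoorePenrose_of_isUnit_transpose_mul_self h)

theorem pinv_of_isUnit_self_mul_transpose {m n : Type*} [Fintype m] [Fintype n]
    [DecidableEq m] {M : Matrix m n ℝ} (h : IsUnit (M * Mᵀ).det) :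
    pinv M = Mᵀ * (M * Mᵀ)⁻¹ :=
  (isMoorePenrose_pinv _).unique (isMoorePenrose_of_isUnit_self_mul_transpose h)

theorem Matrix.rank_le_rank_pinv {m n : Type*} [Fintype m] [Fintype n] (M : Matrix m n ℝ) :
    M.rank ≤ (pinv M).rank := by
  calc M.rank = (M * pinv M * M).rank := by rw [(isMoorePenrose_pinv M).mul_mul_self]
    _ ≤ (M * pinv M).rank := rank_mul_le_left _ _
    _ ≤ (pinv M).rank := rank_mul_le_right _ _

/-! ### A lower bound for `F` -/

/-- The `qᵢ` come from an orthonormal basis of `(ker B)ᗮ`, whose dimension is the rank of `B`. -/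
theorem exists_orthonormal_forall_inner_eq_zero_of_mulVec_eq_zero {n p k : ℕ}
    {B : Matrix (Fin n) (Fin p) ℝ}
    (hB : k ≤ B.rank) : ∃ q : Fin k → EuclideanSpace ℝ (Fin p), Orthonormal ℝ q ∧
      ∀ i v, B *ᵥ (WithLp.ofLp v) = 0 → inner ℝ (q i) v = 0 := by
  set T := toEuclideanLin (𝕜 := ℝ) B with hT
  set K : Submodule ℝ (EuclideanSpace ℝ (Fin p)) := (LinearMap.ker T)ᗮ with hK
  have hdim : k ≤ Module.finrank ℝ K := by
    have h1 := (LinearMap.ker T).finrank_add_finrank_orthogonal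
    rw [← hK] at h1
    have h2 := T.finrank_range_add_finrank_ker
    have h3 : B.rank = Module.finrank ℝ (LinearMap.range T) :=
      rank_eq_finrank_range_toLin B (EuclideanSpace.basisFun _ ℝ).toBasis
        (EuclideanSpace.basisFun _ ℝ).toBasis
    omega
  refine ⟨fun i => (stdOrthonormalBasis ℝ K (Fin.castLE hdim i) : K), ?_, fun i v hv => ?_⟩
  · exact ((stdOrthonormalBasis ℝ K).orthonormal.comp_linearIsometry K.subtypeₗᵢ).comp _
      (Fin.castLE_injective hdim)
  · have hv' : v ∈ LinearMap.ker T := by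
      rw [LinearMap.mem_ker, hT]
      ext j
      simpa using congrFun hv j
    exact Submodule.inner_left_of_mem_orthogonal hv'
      (stdOrthonormalBasis ℝ K (Fin.castLE hdim i)).2

theorem Matrix.sum_vecMul_sq_le {m n : Type*} [Fintype m] [Fintype n] (Z : Matrix m n ℝ)
    (u : m → ℝ) : ∑ j, (u ᵥ* Z) j ^ 2 ≤ (∑ i, ∑ j, Z i j ^ 2) * (u ⬝ᵥ u) := by
  rw [Finset.sum_comm, Finset.sum_mul]
  refine Finset.sum_le_sum fun j _ => ?_
  have := Finset.sum_mul_sq_le_sq_mul_sq Finset.univ (fun i => Z i j) u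
  simpa [vecMul, dotProduct, mul_comm, pow_two] using this

/-- With `B = (Y⁺)ᵀ A` and `u = B h`, the identity `B Zᵀ B = B` shows that `h` and `h' = Zᵀ u`
differ by an element of `ker B`, so they have the same inner products with the `qᵢ`. Bessel bounds
the sum by `‖h'‖²`, Cauchy–Schwarz bounds that by `‖Z‖² (u·u)`, and `u·u` is `F`. -/
theorem exists_orthonormal_sum_inner_sq_le_mul_statF {n p k : ℕ}
    {A : Matrix (Fin p) (Fin p) ℝ} (hA : IsUnit A.det) (hAs : Aᵀ = A)
    {Z : Matrix (Fin n) (Fin p) ℝ} (hZ : k ≤ (Z * A).rank) :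
    ∃ q : Fin k → EuclideanSpace ℝ (Fin p), Orthonormal ℝ q ∧
      ∀ h : EuclideanSpace ℝ (Fin p), ∑ i, inner ℝ (q i) h ^ 2 ≤
        (∑ i, ∑ j, Z i j ^ 2) * statF (A *ᵥ WithLp.ofLp h) ((Z * A)ᵀ * (Z * A)) := by
  set B : Matrix (Fin n) (Fin p) ℝ := (pinv (Z * A))ᵀ * A with hB
  have hBZB : B * Zᵀ * B = B := by
    have h1 : (pinv (Z * A))ᵀ * (Z * A)ᵀ * (pinv (Z * A))ᵀ = (pinv (Z * A))ᵀ := by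
      rw [← transpose_mul, ← transpose_mul, ← Matrix.mul_assoc,
        (isMoorePenrose_pinv _).mul_mul_inv]
    rw [transpose_mul, hAs] at h1
    rw [hB]
    conv_rhs => rw [← h1]
    simp only [Matrix.mul_assoc]
  have hrank : k ≤ B.rank := by
    rw [hB, rank_mul_eq_left_of_isUnit_det _ _ hA, rank_transpose]
    exact hZ.trans (rank_le_rank_pinv _)
  obtain ⟨q, hq, hqB⟩ := exists_orthonormal_forall_inner_eq_zero_of_mulVec_eq_zero hrank
  refine ⟨q, hq, fun h => ?_⟩
  set u := B *ᵥ WithLp.ofLp h with hu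
  have hstat : statF (A *ᵥ WithLp.ofLp h) ((Z * A)ᵀ * (Z * A)) = u ⬝ᵥ u := by
    rw [statF_transpose_mul_self, mulVec_mulVec]
  set h' : EuclideanSpace ℝ (Fin p) := WithLp.toLp 2 (u ᵥ* Z) with hh'
  have hin : ∀ i, inner ℝ (q i) h = inner ℝ (q i) h' := by
    intro i
    rw [← sub_eq_zero, ← inner_sub_right]
    apply hqB
    rw [hh', WithLp.ofLp_sub, mulVec_sub, sub_eq_zero]
    change _ = B *ᵥ (u ᵥ* Z)
    rw [← mulVec_transpose, hu, mulVec_mulVec, mulVec_mulVec, hBZB]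
  calc ∑ i, inner ℝ (q i) h ^ 2 = ∑ i, ‖inner ℝ (q i) h'‖ ^ 2 := by simp [hin]
    _ ≤ ‖h'‖ ^ 2 := hq.sum_inner_products_le h'
    _ = ∑ j, (u ᵥ* Z) j ^ 2 := by simp [EuclideanSpace.real_norm_sq_eq, hh']
    _ ≤ _ := by
      rw [hstat]
      exact sum_vecMul_sq_le Z u

/-! ### Traces of the derivative of `Y ↦ (Y⁺)ᵀ x` -/

theorem Matrix.mulVec_left_cancel_of_isUnit_det {n : Type*} [Fintype n] [DecidableEq n]
    {W : Matrix n n ℝ} (hW : IsUnit W.det) {a b : n → ℝ} (h : W *ᵥ a = W *ᵥ b) : a = b :=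
  mulVec_injective_iff_isUnit.2 ((isUnit_iff_isUnit_det _).2 hW) h

theorem Matrix.vecMulVec_mulVec_eq_smul {m n : Type*} [Fintype n] (a : m → ℝ) (b c : n → ℝ) :
    vecMulVec a b *ᵥ c = (b ⬝ᵥ c) • a := by
  rw [vecMulVec_mulVec]
  simp

section Traces

variable {n p : Type*} [Fintype n] [Fintype p] [DecidableEq n] [DecidableEq p]
  {A : Matrix p p ℝ} {Z : Matrix n p ℝ} {x : p → ℝ} {u : n → ℝ} {d : Matrix n p ℝ → n → ℝ}

/-- For `Z A` of full row rank, the traces of a linear map `d` determined by the equation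
satisfied by the derivative of `Z ↦ ((Z A)⁺)ᵀ x`. -/
theorem traces_of_isUnit_self_mul_transpose
    (hW : IsUnit (Z * A * (Z * A)ᵀ).det) (hu : (Z * A) *ᵥ (x - (Z * A)ᵀ *ᵥ u) = 0)
    (hd : ∀ M, (Z * A * (Z * A)ᵀ) *ᵥ d M =
      (M * A) *ᵥ (x - (Z * A)ᵀ *ᵥ u) - (Z * A) *ᵥ ((M * A)ᵀ *ᵥ u)) :
    u ⬝ᵥ d (vecMulVec u (u ᵥ* Z)) = -(u ⬝ᵥ u) ^ 2 ∧
    ∑ i, d (vecMulVec (Pi.single i 1) (u ᵥ* Z)) i = -(u ⬝ᵥ u) ∧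
    ∑ j, (d (vecMulVec u (Pi.single j 1)) ᵥ* Z) j = -(Fintype.card n * (u ⬝ᵥ u)) := by
  set Y := Z * A with hY
  set e := x - Yᵀ *ᵥ u with he
  set W := Y * Yᵀ with hWdef
  have hye : (u ᵥ* Y) ⬝ᵥ e = 0 := by rw [← dotProduct_mulVec, hu, dotProduct_zero]
  have hWu : Y *ᵥ (u ᵥ* Y) = W *ᵥ u := by
    rw [← mulVec_transpose, mulVec_mulVec]
  have hdir : ∀ a : n → ℝ, vecMulVec a (u ᵥ* Z) * A = vecMulVec a (u ᵥ* Y) := by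
    intro a
    rw [vecMulVec_mul, vecMul_vecMul]
  -- In the direction `a (uᵀ Z)` the residual term vanishes because `Yᵀ u` is orthogonal to `e`; the
  -- other term is `-(a·u) W u`, and `W` cancels.
  have hd1 : ∀ a : n → ℝ, d (vecMulVec a (u ᵥ* Z)) = -(a ⬝ᵥ u) • u := by
    intro a
    apply mulVec_left_cancel_of_isUnit_det hW
    rw [hd, hdir, vecMulVec_mulVec_eq_smul, hye, transpose_vecMulVec, vecMulVec_mulVec]
    simp [mulVec_smul, hWu, mulVec_neg]
  refine ⟨?_, ?_, ?_⟩
  · rw [hd1, dotProduct_smul, smul_eq_mul]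
    ring
  · simp only [hd1, single_one_dotProduct, Pi.smul_apply, smul_eq_mul, neg_mul,
      Finset.sum_neg_distrib]
    rfl
  · have hd2 : ∀ j, d (vecMulVec u (Pi.single j 1)) =
        (A *ᵥ e) j • (W⁻¹ *ᵥ u) - (u ⬝ᵥ u) • ((W⁻¹ * Y) *ᵥ A.row j) := by
      intro j
      apply mulVec_left_cancel_of_isUnit_det hW
      rw [hd, vecMulVec_mul, single_one_vecMul, vecMulVec_mulVec_eq_smul, transpose_vecMulVec,
        vecMulVec_mulVec_eq_smul, mulVec_sub, mulVec_smul, mulVec_smul, mulVec_smul, mulVec_mulVec,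
        mulVec_mulVec, ← Matrix.mul_assoc, mul_nonsing_inv _ hW, one_mulVec, Matrix.one_mul]
      rfl
    have e1 : ∑ j, (A *ᵥ e) j * ((W⁻¹ *ᵥ u) ᵥ* Z) j = 0 := by
      have : ∑ j, (A *ᵥ e) j * ((W⁻¹ *ᵥ u) ᵥ* Z) j = ((W⁻¹ *ᵥ u) ᵥ* Z) ⬝ᵥ (A *ᵥ e) := by
        simp [dotProduct, mul_comm]
      rw [this, ← dotProduct_mulVec, mulVec_mulVec, hu, dotProduct_zero]
    -- This sum is `tr (W⁻¹ Y Yᵀ)`, the trace of the identity of size `n`.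
    have e2 : ∑ j, (((W⁻¹ * Y) *ᵥ A.row j) ᵥ* Z) j = Fintype.card n := by
      have h1 : ∑ j, (((W⁻¹ * Y) *ᵥ A.row j) ᵥ* Z) j = (W⁻¹ * Y * Aᵀ * Zᵀ).trace := by
        rw [trace_mul_comm]
        simp only [trace, diag, mul_apply (M := Zᵀ), vecMul, dotProduct, transpose_apply]
        refine Finset.sum_congr rfl fun j _ => Finset.sum_congr rfl fun k _ => ?_
        rw [mul_comm]
        rfl
      rw [h1, Matrix.mul_assoc, ← transpose_mul, ← hY, Matrix.mul_assoc, ← hWdef,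
        nonsing_inv_mul _ hW, trace_one]
    simp only [hd2, sub_vecMul, smul_vecMul, Pi.sub_apply, Pi.smul_apply, smul_eq_mul,
      Finset.sum_sub_distrib, e1, ← Finset.mul_sum, e2]
    ring

/-- For `Z A` of full column rank, the traces of a linear map `d` determined by the equations
satisfied by the derivative of `Z ↦ ((Z A)⁺)ᵀ x`. -/
theorem traces_of_isUnit_transpose_mul_self (hA : IsUnit A.det)
    (hN : IsUnit ((Z * A)ᵀ * (Z * A)).det) {c : p → ℝ} {d' : Matrix n p ℝ → p → ℝ}
    (huc : u = (Z * A) *ᵥ c) (hux : (Z * A)ᵀ *ᵥ u = x)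
    (hd : ∀ M, d M = (M * A) *ᵥ c + (Z * A) *ᵥ d' M)
    (hd' : ∀ M, (M * A)ᵀ *ᵥ u + (Z * A)ᵀ *ᵥ d M = 0) :
    u ⬝ᵥ d (vecMulVec u (u ᵥ* Z)) = -(u ⬝ᵥ u) ^ 2 ∧
    ∑ i, d (vecMulVec (Pi.single i 1) (u ᵥ* Z)) i =
      (Fintype.card n - Fintype.card p - 1) * (u ⬝ᵥ u) ∧
    ∑ j, (d (vecMulVec u (Pi.single j 1)) ᵥ* Z) j = -(Fintype.card p * (u ⬝ᵥ u)) := by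
  set Y := Z * A with hY
  set N := Yᵀ * Y with hNdef
  have hNc : N *ᵥ c = x := by rw [hNdef, ← mulVec_mulVec, ← huc, hux]
  have hxc : x ⬝ᵥ c = u ⬝ᵥ u := by
    conv_rhs => rw [huc, dotProduct_mulVec, ← mulVec_transpose, ← huc, hux]
  have hx : u ᵥ* Y = x := by rw [← mulVec_transpose, hux]
  have hdir : ∀ a : n → ℝ, vecMulVec a (u ᵥ* Z) * A = vecMulVec a x := by
    intro a
    rw [vecMulVec_mul, vecMul_vecMul, ← hY, hx]
  -- Substituting `hd` into `hd'` determines `d' M`. The result contains the projection `Y N⁻¹ Yᵀ`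
  -- onto the range of `Y`, which fixes `u` and has trace `p`.
  have hd1 : ∀ a : n → ℝ, d (vecMulVec a (u ᵥ* Z)) =
      (u ⬝ᵥ u) • a - (a ⬝ᵥ u) • u - (u ⬝ᵥ u) • ((Y * N⁻¹ * Yᵀ) *ᵥ a) := by
    intro a
    set M := vecMulVec a (u ᵥ* Z) with hM
    have h1 := hd' M
    rw [hd M, hdir, vecMulVec_mulVec_eq_smul, transpose_vecMulVec, vecMulVec_mulVec_eq_smul, hxc,
      mulVec_add, mulVec_mulVec, ← hNdef] at h1
    have h2 : d' M = -(a ⬝ᵥ u) • c - (u ⬝ᵥ u) • (N⁻¹ *ᵥ (Yᵀ *ᵥ a)) := by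
      apply mulVec_left_cancel_of_isUnit_det hN
      rw [mulVec_sub, mulVec_smul, mulVec_smul, hNc, mulVec_mulVec, mul_nonsing_inv _ hN,
        one_mulVec]
      simp only [mulVec_smul] at h1
      rw [← sub_eq_zero, ← h1]
      simp only [neg_smul]
      abel
    rw [hd M, hdir, h2, vecMulVec_mulVec_eq_smul, hxc, mulVec_sub, mulVec_smul, mulVec_smul, ← huc,
      mulVec_mulVec a, mulVec_mulVec a, ← Matrix.mul_assoc]
    simp only [neg_smul]
    abel
  refine ⟨?_, ?_, ?_⟩
  · have h1 : (Y * N⁻¹ * Yᵀ) *ᵥ u = u := by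
      rw [← mulVec_mulVec, hux, ← mulVec_mulVec, ← hNc, mulVec_mulVec c, nonsing_inv_mul _ hN,
        one_mulVec, ← huc]
    rw [hd1, h1]
    simp only [dotProduct_sub, dotProduct_smul, smul_eq_mul]
    ring
  · have h1 : ∑ i, ((Y * N⁻¹ * Yᵀ) *ᵥ Pi.single i 1) i = Fintype.card p := by
      have : ∑ i, ((Y * N⁻¹ * Yᵀ) *ᵥ Pi.single i 1) i = (Y * N⁻¹ * Yᵀ).trace := by
        simp [trace]
      rw [this, Matrix.mul_assoc, trace_mul_comm, Matrix.mul_assoc, ← hNdef,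
        nonsing_inv_mul _ hN, trace_one]
    simp only [hd1, Pi.sub_apply, Pi.smul_apply, smul_eq_mul, Finset.sum_sub_distrib,
      ← Finset.mul_sum, h1]
    simp only [Pi.single_eq_same, Finset.sum_const, Finset.card_univ, single_one_dotProduct,
      nsmul_eq_mul]
    rw [show ∑ i, u i * u i = u ⬝ᵥ u from rfl]
    ring
  · have hd2 : ∀ j, d (vecMulVec u (Pi.single j 1)) ᵥ* Z = -(u ⬝ᵥ u) • Pi.single j 1 := by
      intro j
      have h1 := hd' (vecMulVec u (Pi.single j 1))
      rw [vecMulVec_mul, transpose_vecMulVec, vecMulVec_mulVec_eq_smul, mulVec_transpose] at h1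
      have h2 : d (vecMulVec u (Pi.single j 1)) ᵥ* Y = -(u ⬝ᵥ u) • (Pi.single j 1 ᵥ* A) := by
        rw [neg_smul, eq_neg_iff_add_eq_zero, add_comm, ← h1]
      have h3 := congrArg (fun t => t ᵥ* A⁻¹) h2
      rw [vecMul_vecMul, hY, Matrix.mul_assoc, mul_nonsing_inv _ hA, Matrix.mul_one, smul_vecMul,
        vecMul_vecMul, mul_nonsing_inv _ hA, vecMul_one] at h3
      exact h3
    simp [hd2]

end Traces

/-! ### Differentiation of matrix expressions -/

theorem HasDerivAt.dotProduct {ι : Type*} [Fintype ι] {a b : ℝ → ι → ℝ} {a' b' : ι → ℝ} {t : ℝ}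
    (ha : HasDerivAt a a' t) (hb : HasDerivAt b b' t) :
    HasDerivAt (fun s => a s ⬝ᵥ b s) (a' ⬝ᵥ b t + a t ⬝ᵥ b') t := by
  have := HasDerivAt.fun_sum (u := Finset.univ) fun i _ =>
    (hasDerivAt_pi.1 ha i).mul (hasDerivAt_pi.1 hb i)
  rw [Finset.sum_add_distrib] at this
  exact this

theorem HasDerivAt.matrix_mulVec {m n : Type*} [Fintype m] [Fintype n] {M : ℝ → Matrix m n ℝ}
    {M' : Matrix m n ℝ} {b : ℝ → n → ℝ} {b' : n → ℝ} {t : ℝ}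
    (hM : ∀ i j, HasDerivAt (fun s => M s i j) (M' i j) t) (hb : HasDerivAt b b' t) :
    HasDerivAt (fun s => M s *ᵥ b s) (M' *ᵥ b t + M t *ᵥ b') t :=
  hasDerivAt_pi.2 fun i => (hasDerivAt_pi.2 fun j => hM i j).dotProduct hb

section Entrywise

variable {V : Type*} [NormedAddCommGroup V] [NormedSpace ℝ V] {v : V}

theorem differentiableAt_mul_apply {l m n : Type*} [Fintype m] {M : V → Matrix l m ℝ}
    {N : V → Matrix m n ℝ} (hM : ∀ i j, DifferentiableAt ℝ (fun w => M w i j) v)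
    (hN : ∀ i j, DifferentiableAt ℝ (fun w => N w i j) v) (i : l) (j : n) :
    DifferentiableAt ℝ (fun w => (M w * N w) i j) v := by
  simp only [mul_apply]
  exact DifferentiableAt.fun_sum fun k _ => (hM i k).mul (hN k j)

theorem differentiableAt_mulVec {m n : Type*} [Fintype m] [Fintype n] {M : V → Matrix m n ℝ}
    {b : V → n → ℝ} (hM : ∀ i j, DifferentiableAt ℝ (fun w => M w i j) v)
    (hb : DifferentiableAt ℝ b v) : DifferentiableAt ℝ (fun w => M w *ᵥ b w) v := by
  refine differentiableAt_pi.2 fun i => ?_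
  simp only [mulVec, _root_.dotProduct]
  exact DifferentiableAt.fun_sum fun k _ => (hM i k).mul (differentiableAt_pi.1 hb k)

theorem differentiableAt_det {n : Type*} [Fintype n] [DecidableEq n] {M : V → Matrix n n ℝ}
    (hM : ∀ i j, DifferentiableAt ℝ (fun w => M w i j) v) :
    DifferentiableAt ℝ (fun w => (M w).det) v := by
  simp only [det_apply]
  refine DifferentiableAt.fun_sum fun σ _ => ?_
  exact (HasFDerivAt.finsetProd fun i _ =>
    (hM (σ i) i).hasFDerivAt).differentiableAt.const_smul _

theorem differentiableAt_inv_apply {n : Type*} [Fintype n] [DecidableEq n] {M : V → Matrix n n ℝ}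
    (hM : ∀ i j, DifferentiableAt ℝ (fun w => M w i j) v) (h : IsUnit (M v).det) (i j : n) :
    DifferentiableAt ℝ (fun w => (M w)⁻¹ i j) v := by
  simp only [inv_def, Matrix.smul_apply, Ring.inverse_eq_inv', smul_eq_mul, adjugate_apply]
  refine ((differentiableAt_det hM).inv h.ne_zero).mul (differentiableAt_det fun k l => ?_)
  simp only [updateRow_apply]
  split_ifs
  · exact differentiableAt_const _
  · exact hM k l

end Entrywise

/-! ### The divergence of a rank one field -/

section RankOne

variable {n p : ℕ} {u : (Fin p × Fin n → ℝ) → Fin n → ℝ}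
  {u' : (Fin p × Fin n → ℝ) →L[ℝ] Fin n → ℝ} {v : Fin p × Fin n → ℝ}

theorem map_vec_eq_sum (u' : (Fin p × Fin n → ℝ) →L[ℝ] Fin n → ℝ) (M : Matrix (Fin n) (Fin p) ℝ) :
    u' (vec M) = ∑ k : Fin p × Fin n, M k.2 k.1 • u' (Pi.single k 1) := by
  have h : vec M = ∑ k : Fin p × Fin n, M k.2 k.1 • (Pi.single k 1 : Fin p × Fin n → ℝ) := by
    ext k
    simp [vec, Finset.sum_apply, Pi.single_apply]
  rw [h, map_sum]
  simp

theorem hasDerivAt_rankOne_line (hu : HasFDerivAt u u' v) {φ : ℝ → ℝ} {φ' : ℝ}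
    (hφ : HasDerivAt φ φ' (u v ⬝ᵥ u v)) (k : Fin p × Fin n) :
    HasDerivAt (fun t : ℝ => (vec (φ (u (v + t • Pi.single k 1) ⬝ᵥ u (v + t • Pi.single k 1)) •
      vecMulVec (u (v + t • Pi.single k 1))
        (u (v + t • Pi.single k 1) ᵥ* unvec (v + t • Pi.single k 1))) : Fin p × Fin n → ℝ) k)
      (2 * φ' * (u v ⬝ᵥ u' (Pi.single k 1)) * (u v k.2 * (u v ᵥ* unvec v) k.1) +
        φ (u v ⬝ᵥ u v) * (u' (Pi.single k 1) k.2 * (u v ᵥ* unvec v) k.1 +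
          u v k.2 * ((u' (Pi.single k 1) ᵥ* unvec v) k.1 + u v k.2))) 0 := by
  obtain ⟨j, i⟩ := k
  set e : Fin p × Fin n → ℝ := Pi.single (j, i) 1 with he
  have h1 : HasDerivAt (fun t : ℝ => u (v + t • e)) (u' e) 0 := hu.hasLineDerivAt e
  have h2 : HasDerivAt (fun t : ℝ => fun l => unvec (v + t • e) l j) (Pi.single i 1) 0 := by
    refine hasDerivAt_pi.2 fun l => ?_
    have := ((hasDerivAt_id (0 : ℝ)).mul_const (e (j, l))).const_add (v (j, l))
    refine this.congr_deriv ?_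
    simp [he, Pi.single_apply]
  have h3 := h1.dotProduct h2
  have h4 := h1.dotProduct h1
  have hφ' : HasDerivAt φ φ' (u (v + (0 : ℝ) • e) ⬝ᵥ u (v + (0 : ℝ) • e)) := by simpa using hφ
  have h5 := (hφ'.comp (0 : ℝ) h4).mul ((hasDerivAt_pi.1 h1 i).mul h3)
  refine h5.congr_deriv ?_
  simp only [zero_smul, add_zero, dotProduct_single_one, Function.comp_apply, Pi.mul_apply]
  rw [dotProduct_comm (u' e) (u v), show (u v ⬝ᵥ fun l => unvec v l j) = (u v ᵥ* unvec v) j from rfl,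
    show (u' e ⬝ᵥ fun l => unvec v l j) = (u' e ᵥ* unvec v) j from rfl]
  ring

theorem differentiableAt_rankOne (hu : DifferentiableAt ℝ u v) {φ : ℝ → ℝ}
    (hφ : DifferentiableAt ℝ φ (u v ⬝ᵥ u v)) :
    DifferentiableAt ℝ (fun w => (vec (φ (u w ⬝ᵥ u w) • vecMulVec (u w) (u w ᵥ* unvec w)) :
      Fin p × Fin n → ℝ)) v := by
  have hu1 := differentiableAt_pi.1 hu
  refine differentiableAt_pi.2 fun k => ?_
  refine DifferentiableAt.mul (DifferentiableAt.comp (g := φ) v hφ ?_)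
    ((hu1 k.2).mul ?_)
  · exact DifferentiableAt.fun_sum fun i _ => (hu1 i).mul (hu1 i)
  · change DifferentiableAt ℝ (fun w => ∑ i, u w i * w (k.1, i)) v
    refine DifferentiableAt.fun_sum fun i _ => (hu1 i).mul ?_
    exact differentiableAt_apply (k.1, i) v

/-- The product rule hits `φ`, each of the two factors `u`, and the explicit `Z`; the last
contributes `p (u·u)`. Linearity of `u'` collects the coordinate derivatives into values at rank one
directions. -/
theorem divergence_rankOne (hu : HasFDerivAt u u' v) {φ : ℝ → ℝ} {φ' : ℝ}
    (hφ : HasDerivAt φ φ' (u v ⬝ᵥ u v)) :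
    divergence (fun w => vec (φ (u w ⬝ᵥ u w) • vecMulVec (u w) (u w ᵥ* unvec w))) v =
      2 * φ' * (u v ⬝ᵥ u' (vec (vecMulVec (u v) (u v ᵥ* unvec v)))) + φ (u v ⬝ᵥ u v) *
        (∑ i, u' (vec (vecMulVec (Pi.single i 1) (u v ᵥ* unvec v))) i +
          ∑ j, (u' (vec (vecMulVec (u v) (Pi.single j 1))) ᵥ* unvec v) j +
          p * (u v ⬝ᵥ u v)) := by
  have hg := differentiableAt_rankOne hu.differentiableAt hφ.differentiableAt
  have hpart : ∀ k : Fin p × Fin n, fderiv ℝ (fun w =>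
      vec (φ (u w ⬝ᵥ u w) • vecMulVec (u w) (u w ᵥ* unvec w))) v (Pi.single k 1) k =
      2 * φ' * (u v ⬝ᵥ u' (Pi.single k 1)) * (u v k.2 * (u v ᵥ* unvec v) k.1) +
        φ (u v ⬝ᵥ u v) * (u' (Pi.single k 1) k.2 * (u v ᵥ* unvec v) k.1 +
          u v k.2 * ((u' (Pi.single k 1) ᵥ* unvec v) k.1 + u v k.2)) := fun k =>
    (hasDerivAt_pi.1 (hg.hasFDerivAt.hasLineDerivAt (Pi.single k 1)) k).unique
      (hasDerivAt_rankOne_line hu hφ k)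
  have s1 : u v ⬝ᵥ u' (vec (vecMulVec (u v) (u v ᵥ* unvec v))) =
      ∑ k : Fin p × Fin n, (u v ⬝ᵥ u' (Pi.single k 1)) * (u v k.2 * (u v ᵥ* unvec v) k.1) := by
    rw [map_vec_eq_sum, dotProduct_sum]
    refine Finset.sum_congr rfl fun k _ => ?_
    rw [dotProduct_smul, vecMulVec_apply, smul_eq_mul, mul_comm]
  have s2 : ∑ i, u' (vec (vecMulVec (Pi.single i 1) (u v ᵥ* unvec v))) i =
      ∑ k : Fin p × Fin n, u' (Pi.single k 1) k.2 * (u v ᵥ* unvec v) k.1 := by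
    simp only [map_vec_eq_sum, vecMulVec_apply, Finset.sum_apply, Pi.smul_apply, smul_eq_mul]
    rw [Finset.sum_comm]
    refine Finset.sum_congr rfl fun k _ => ?_
    rw [Finset.sum_eq_single k.2]
    · simp [mul_comm]
    · intro i _ hi
      simp [hi.symm]
    · simp
  have s3 : ∑ j, (u' (vec (vecMulVec (u v) (Pi.single j 1))) ᵥ* unvec v) j =
      ∑ k : Fin p × Fin n, u v k.2 * (u' (Pi.single k 1) ᵥ* unvec v) k.1 := by
    simp only [map_vec_eq_sum, vecMulVec_apply, sum_vecMul, smul_vecMul, Finset.sum_apply,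
      Pi.smul_apply, smul_eq_mul]
    rw [Finset.sum_comm]
    refine Finset.sum_congr rfl fun k _ => ?_
    rw [Finset.sum_eq_single k.1]
    · simp
    · intro j _ hj
      simp [hj.symm]
    · simp
  have s4 : p * (u v ⬝ᵥ u v) = ∑ k : Fin p × Fin n, u v k.2 * u v k.2 := by
    rw [Fintype.sum_prod_type]
    simp [_root_.dotProduct]
  rw [divergence, s1, s2, s3, s4]
  simp only [hpart, mul_add, Finset.sum_add_distrib, Finset.mul_sum]
  simp only [mul_assoc]
  ring

end RankOne

/-! ### The divergence of `vecField` at points of full rank -/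

theorem IsMoorePenrose.self_mulVec_sub {m n : Type*} [Fintype m] [Fintype n]
    {M : Matrix m n ℝ} {B : Matrix n m ℝ} (h : IsMoorePenrose M B) (x : n → ℝ) :
    M *ᵥ (x - Mᵀ *ᵥ (Bᵀ *ᵥ x)) = 0 := by
  rw [mulVec_sub, mulVec_mulVec x Mᵀ, ← transpose_mul, h.symm_right, mulVec_mulVec,
    ← Matrix.mul_assoc, h.mul_mul_self, sub_self]

theorem IsMoorePenrose.transpose_mulVec_eq {m n : Type*} [Fintype m] [Fintype n]
    {M : Matrix m n ℝ} {B : Matrix n m ℝ} (h : IsMoorePenrose M B) (x : n → ℝ) :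
    Bᵀ *ᵥ x = M *ᵥ ((B * Bᵀ) *ᵥ x) := by
  rw [mulVec_mulVec, ← Matrix.mul_assoc, ← h.symm_left, ← transpose_mul, ← Matrix.mul_assoc,
    h.mul_mul_inv]

section FullRank

variable {n p : ℕ} {A : Matrix (Fin p) (Fin p) ℝ} {x : Fin p → ℝ} {v : Fin p × Fin n → ℝ}

theorem differentiable_unvec_mul_apply (A : Matrix (Fin p) (Fin p) ℝ) (i : Fin n) (j : Fin p) :
    Differentiable ℝ (fun w : Fin p × Fin n → ℝ => (unvec w * A) i j) := by
  intro v
  refine differentiableAt_mul_apply (M := unvec) (N := fun _ => A) (fun i j => ?_)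
    (fun i j => differentiableAt_const _) i j
  exact differentiableAt_apply (j, i) v

/-- Invertibility of the Gram matrix is an open condition, so the explicit formula for the
pseudoinverse is valid on a neighbourhood of `v`. -/
theorem differentiableAt_pinv_of_isUnit_self_mul_transpose
    (h : IsUnit (unvec v * A * (unvec v * A)ᵀ).det) (i : Fin p) (j : Fin n) :
    DifferentiableAt ℝ (fun w : Fin p × Fin n → ℝ => pinv (unvec w * A) i j) v := by
  have hY : ∀ i j, DifferentiableAt ℝ (fun w : Fin p × Fin n → ℝ => (unvec w * A) i j) v :=
    fun i j => differentiable_unvec_mul_apply A i j v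
  have hW := differentiableAt_mul_apply hY (N := fun w => (unvec w * A)ᵀ) fun i j => hY j i
  have hev : ∀ᶠ w in nhds v, (unvec w * A * (unvec w * A)ᵀ).det ≠ 0 :=
    (differentiableAt_det hW).continuousAt.eventually_ne h.ne_zero
  refine DifferentiableAt.congr_of_eventuallyEq (differentiableAt_mul_apply
    (M := fun w => (unvec w * A)ᵀ) (fun i j => hY j i) (differentiableAt_inv_apply hW h) i j) ?_
  filter_upwards [hev] with w hw
  rw [pinv_of_isUnit_self_mul_transpose (isUnit_iff_ne_zero.2 hw)]

theorem differentiableAt_pinv_of_isUnit_transpose_mul_self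
    (h : IsUnit ((unvec v * A)ᵀ * (unvec v * A)).det) (i : Fin p) (j : Fin n) :
    DifferentiableAt ℝ (fun w : Fin p × Fin n → ℝ => pinv (unvec w * A) i j) v := by
  have hY : ∀ i j, DifferentiableAt ℝ (fun w : Fin p × Fin n → ℝ => (unvec w * A) i j) v :=
    fun i j => differentiable_unvec_mul_apply A i j v
  have hW := differentiableAt_mul_apply (M := fun w : Fin p × Fin n → ℝ => (unvec w * A)ᵀ)
    (fun i j => hY j i) hY
  have hev : ∀ᶠ w in nhds v, ((unvec w * A)ᵀ * (unvec w * A)).det ≠ 0 :=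
    (differentiableAt_det hW).continuousAt.eventually_ne h.ne_zero
  refine DifferentiableAt.congr_of_eventuallyEq (differentiableAt_mul_apply
    (differentiableAt_inv_apply hW h) (N := fun w => (unvec w * A)ᵀ) (fun i j => hY j i) i j) ?_
  filter_upwards [hev] with w hw
  rw [pinv_of_isUnit_transpose_mul_self (isUnit_iff_ne_zero.2 hw)]

theorem hasDerivAt_unvec_mul_line (A : Matrix (Fin p) (Fin p) ℝ) (v : Fin p × Fin n → ℝ)
    (M : Matrix (Fin n) (Fin p) ℝ) (i : Fin n) (j : Fin p) :
    HasDerivAt (fun t : ℝ => (unvec (v + t • vec M) * A) i j) ((M * A) i j) 0 := by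
  have h : ∀ t : ℝ, (unvec (v + t • vec M) * A) i j =
      (unvec v * A) i j + t * (M * A) i j := by
    intro t
    have : unvec (v + t • vec M) = unvec v + t • M := rfl
    rw [this, Matrix.add_mul, Matrix.smul_mul]
    rfl
  simp only [h]
  simpa using ((hasDerivAt_id (0 : ℝ)).mul_const ((M * A) i j)).const_add ((unvec v * A) i j)

/-- The traces of the derivative of `Z ↦ u = ((Z A)⁺)ᵀ x` that enter the divergence of the
rank one field, at a matrix `Z A` of full rank `m`. -/
def HasPinvTraces (A : Matrix (Fin p) (Fin p) ℝ) (x : Fin p → ℝ) (m : ℕ)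
    (v : Fin p × Fin n → ℝ) (u : Fin n → ℝ)
    (u' : (Fin p × Fin n → ℝ) →L[ℝ] Fin n → ℝ) : Prop :=
  HasFDerivAt (fun w => (pinv (unvec w * A))ᵀ *ᵥ x) u' v ∧
    u ⬝ᵥ u' (vec (vecMulVec u (u ᵥ* unvec v))) = -(u ⬝ᵥ u) ^ 2 ∧
    ∑ i, u' (vec (vecMulVec (Pi.single i 1) (u ᵥ* unvec v))) i +
      ∑ j, (u' (vec (vecMulVec u (Pi.single j 1))) ᵥ* unvec v) j =
        (n - 2 * m - 1) * (u ⬝ᵥ u)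

/-- The equation for `du` comes from differentiating `Y (x - Yᵀ u) = 0` along lines; this identity
holds at every matrix. -/
theorem exists_hasPinvTraces_of_isUnit_self_mul_transpose
    (h : IsUnit (unvec v * A * (unvec v * A)ᵀ).det) :
    ∃ u', HasPinvTraces A x n v ((pinv (unvec v * A))ᵀ *ᵥ x) u' := by
  have hu : DifferentiableAt ℝ (fun w => (pinv (unvec w * A))ᵀ *ᵥ x) v :=
    differentiableAt_mulVec (M := fun w => (pinv (unvec w * A))ᵀ)
      (fun i j => differentiableAt_pinv_of_isUnit_self_mul_transpose h j i)
      (differentiableAt_const x)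
  refine ⟨_, hu.hasFDerivAt, ?_⟩
  set u' := fderiv ℝ (fun w => (pinv (unvec w * A))ᵀ *ᵥ x) v
  have hd : ∀ M : Matrix (Fin n) (Fin p) ℝ, (unvec v * A * (unvec v * A)ᵀ) *ᵥ u' (vec M) =
      (M * A) *ᵥ (x - (unvec v * A)ᵀ *ᵥ ((pinv (unvec v * A))ᵀ *ᵥ x)) -
        (unvec v * A) *ᵥ ((M * A)ᵀ *ᵥ ((pinv (unvec v * A))ᵀ *ᵥ x)) := by
    intro M
    have h1 : HasDerivAt (fun t : ℝ => (pinv (unvec (v + t • vec M) * A))ᵀ *ᵥ x)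
      (u' (vec M)) 0 := hu.hasFDerivAt.hasLineDerivAt (vec M)
    have h2 := HasDerivAt.matrix_mulVec (hasDerivAt_unvec_mul_line A v M)
      ((HasDerivAt.matrix_mulVec (M := fun t : ℝ => (unvec (v + t • vec M) * A)ᵀ)
        (M' := (M * A)ᵀ) (fun i j => hasDerivAt_unvec_mul_line A v M j i) h1).const_sub x)
    have h3 := h2.unique ((hasDerivAt_const (0 : ℝ) (0 : Fin n → ℝ)).congr_of_eventuallyEq
      (Filter.Eventually.of_forall fun t => (isMoorePenrose_pinv _).self_mulVec_sub x))
    simp only [zero_smul, add_zero, mulVec_neg, mulVec_add, mulVec_mulVec] at h3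
    simp only [mulVec_mulVec] at h3 ⊢
    rw [← sub_eq_zero, ← neg_eq_zero, ← h3]
    abel
  obtain ⟨e1, e2, e3⟩ := traces_of_isUnit_self_mul_transpose (d := fun M => u' (vec M)) h
    ((isMoorePenrose_pinv _).self_mulVec_sub x) hd
  refine ⟨e1, ?_⟩
  rw [e2, e3, Fintype.card_fin]
  ring

/-- Two identities are differentiated: `u = Y c` with `c = S⁺ x`, which always holds, and `Yᵀ u =
x`, which holds near `v` because full column rank persists there. -/
theorem exists_hasPinvTraces_of_isUnit_transpose_mul_self (hA : IsUnit A.det)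
    (h : IsUnit ((unvec v * A)ᵀ * (unvec v * A)).det) :
    ∃ u', HasPinvTraces A x p v ((pinv (unvec v * A))ᵀ *ᵥ x) u' := by
  have hP := differentiableAt_pinv_of_isUnit_transpose_mul_self h
  have hu : DifferentiableAt ℝ (fun w => (pinv (unvec w * A))ᵀ *ᵥ x) v :=
    differentiableAt_mulVec (M := fun w => (pinv (unvec w * A))ᵀ)
      (fun i j => hP j i) (differentiableAt_const x)
  have hc : DifferentiableAt ℝ
      (fun w => (pinv (unvec w * A) * (pinv (unvec w * A))ᵀ) *ᵥ x) v :=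
    differentiableAt_mulVec (differentiableAt_mul_apply hP
      (N := fun w => (pinv (unvec w * A))ᵀ) fun i j => hP j i) (differentiableAt_const x)
  refine ⟨_, hu.hasFDerivAt, ?_⟩
  set u' := fderiv ℝ (fun w => (pinv (unvec w * A))ᵀ *ᵥ x) v
  set c' := fderiv ℝ (fun w => (pinv (unvec w * A) * (pinv (unvec w * A))ᵀ) *ᵥ x) v
  have hdet : DifferentiableAt ℝ
      (fun w : Fin p × Fin n → ℝ => ((unvec w * A)ᵀ * (unvec w * A)).det) v :=
    differentiableAt_det (differentiableAt_mul_apply (M := fun w => (unvec w * A)ᵀ)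
      (fun i j => differentiable_unvec_mul_apply A j i v)
      fun i j => differentiable_unvec_mul_apply A i j v)
  have hx : ∀ w : Fin p × Fin n → ℝ, ((unvec w * A)ᵀ * (unvec w * A)).det ≠ 0 →
      (unvec w * A)ᵀ *ᵥ ((pinv (unvec w * A))ᵀ *ᵥ x) = x := by
    intro w hw
    rw [mulVec_mulVec, ← transpose_mul, (isMoorePenrose_pinv _).symm_right,
      pinv_of_isUnit_transpose_mul_self (isUnit_iff_ne_zero.2 hw), Matrix.mul_assoc,
      nonsing_inv_mul _ (isUnit_iff_ne_zero.2 hw), one_mulVec]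
  have hline : ∀ M : Matrix (Fin n) (Fin p) ℝ,
      HasDerivAt (fun t : ℝ => (pinv (unvec (v + t • vec M) * A))ᵀ *ᵥ x) (u' (vec M)) 0 :=
    fun M => hu.hasFDerivAt.hasLineDerivAt (vec M)
  have hd : ∀ M : Matrix (Fin n) (Fin p) ℝ, u' (vec M) =
      (M * A) *ᵥ ((pinv (unvec v * A) * (pinv (unvec v * A))ᵀ) *ᵥ x) +
        (unvec v * A) *ᵥ c' (vec M) := by
    intro M
    have h1 : HasDerivAt (fun t : ℝ => (pinv (unvec (v + t • vec M) * A) *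
        (pinv (unvec (v + t • vec M) * A))ᵀ) *ᵥ x) (c' (vec M)) 0 :=
      hc.hasFDerivAt.hasLineDerivAt (vec M)
    have h2 := HasDerivAt.matrix_mulVec (hasDerivAt_unvec_mul_line A v M) h1
    have h3 := (hline M).unique (h2.congr_of_eventuallyEq
      (Filter.Eventually.of_forall fun t => (isMoorePenrose_pinv _).transpose_mulVec_eq x))
    simpa using h3
  have hd' : ∀ M : Matrix (Fin n) (Fin p) ℝ,
      (M * A)ᵀ *ᵥ ((pinv (unvec v * A))ᵀ *ᵥ x) + (unvec v * A)ᵀ *ᵥ u' (vec M) = 0 := by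
    intro M
    have h2 := HasDerivAt.matrix_mulVec (M := fun t : ℝ => (unvec (v + t • vec M) * A)ᵀ)
      (M' := (M * A)ᵀ) (fun i j => hasDerivAt_unvec_mul_line A v M j i) (hline M)
    have hcont : Filter.Tendsto (fun t : ℝ => v + t • vec M) (nhds 0) (nhds v) :=
      Continuous.tendsto' (by fun_prop) _ _ (by simp)
    have h3 := h2.unique ((hasDerivAt_const (0 : ℝ) x).congr_of_eventuallyEq
      ((hcont.eventually (hdet.continuousAt.eventually_ne h.ne_zero)).mono fun t ht => hx _ ht))
    simpa using h3
  obtain ⟨e1, e2, e3⟩ := traces_of_isUnit_transpose_mul_self (d := fun M => u' (vec M))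
    (d' := fun M => c' (vec M)) hA h ((isMoorePenrose_pinv _).transpose_mulVec_eq x)
    (hx v h.ne_zero) hd hd'
  refine ⟨e1, ?_⟩
  rw [e2, e3, Fintype.card_fin, Fintype.card_fin]
  ring

/-- The traces give `-2 φ'(F) F² + (n + p - 2m - 1) φ(F) F`, and `φ'(F) F² = 2 r r' - 2 r² / F`;
this turns the `-1` into `+3`. -/
theorem HasPinvTraces.divergence_vecField {m : ℕ} {r : ℝ → ℝ} (hr : Differentiable ℝ r)
    (hA : IsUnit A.det) {u'} (h : HasPinvTraces A x m v ((pinv (unvec v * A))ᵀ *ᵥ x) u')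
    (hF : statF x ((unvec v * A)ᵀ * (unvec v * A)) ≠ 0) :
    DifferentiableAt ℝ (vecField (n := n) r A x) v ∧
    divergence (vecField (n := n) r A x) v = (n + p - 2 * m + 3) *
      (r (statF x ((unvec v * A)ᵀ * (unvec v * A))) ^ 2 *
        (statF x ((unvec v * A)ᵀ * (unvec v * A)))⁻¹) -
      4 * (r (statF x ((unvec v * A)ᵀ * (unvec v * A))) *
        deriv r (statF x ((unvec v * A)ᵀ * (unvec v * A)))) := by
  obtain ⟨hu, e1, e2⟩ := h
  have hfield : vecField (n := n) r A x = fun w =>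
      vec ((fun t => r t ^ 2 / t ^ 2) (((pinv (unvec w * A))ᵀ *ᵥ x) ⬝ᵥ
        ((pinv (unvec w * A))ᵀ *ᵥ x)) • vecMulVec ((pinv (unvec w * A))ᵀ *ᵥ x)
          (((pinv (unvec w * A))ᵀ *ᵥ x) ᵥ* unvec w)) := by
    funext w
    rw [vecField, mul_matH r hA]
  rw [statF_transpose_mul_self] at hF ⊢
  set u := (pinv (unvec v * A))ᵀ *ᵥ x
  set F := u ⬝ᵥ u with hFdef
  have hφ : HasDerivAt (fun t => r t ^ 2 / t ^ 2)
      ((2 * r F * deriv r F * F ^ 2 - r F ^ 2 * (2 * F)) / (F ^ 2) ^ 2) F :=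
    (((hr F).hasDerivAt.pow 2).div ((hasDerivAt_id F).pow 2) (pow_ne_zero 2 hF)).congr_deriv
      (by simp)
  rw [hfield]
  refine ⟨differentiableAt_rankOne (u := fun w => (pinv (unvec w * A))ᵀ *ᵥ x)
    hu.differentiableAt hφ.differentiableAt, ?_⟩
  rw [divergence_rankOne (u := fun w => (pinv (unvec w * A))ᵀ *ᵥ x) hu hφ, e1, e2, ← hFdef]
  field_simp
  ring

end FullRank

/-! ### Gaussian matrices have full rank -/

/-- The matrix whose rows are listed one after the other in `y`. -/
def matOfRows (n p : ℕ) : EuclideanSpace ℝ (Fin n × Fin p) →ₗ[ℝ] Matrix (Fin n) (Fin p) ℝ where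
  toFun y := of fun i j => y (i, j)
  map_add' _ _ := rfl
  map_smul' _ _ := rfl

theorem continuous_matOfRows (n p : ℕ) : Continuous (matOfRows n p) :=
  (matOfRows n p).continuous_of_finiteDimensional

theorem Matrix.isUnit_det_self_mul_transpose_of_submatrix {m n : Type*} [Fintype m] [Fintype n]
    [DecidableEq m] {M : Matrix m n ℝ} (f : m → n) (h : (M.submatrix id f).det ≠ 0) :
    IsUnit (M * Mᵀ).det := by
  rw [isUnit_iff_ne_zero]
  intro h0
  obtain ⟨v, hv0, hv⟩ := exists_mulVec_eq_zero_iff.2 h0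
  have h1 : Mᵀ *ᵥ v = 0 := by
    have := (self_mul_conjTranspose_mulVec_eq_zero M v).1
      (by rwa [conjTranspose_eq_transpose_of_trivial])
    rwa [conjTranspose_eq_transpose_of_trivial] at this
  have h2 : (M.submatrix id f)ᵀ *ᵥ v = 0 := funext fun i => congrFun h1 (f i)
  rw [← det_transpose] at h
  exact h (exists_mulVec_eq_zero_iff.1 ⟨v, hv0, h2⟩)

theorem Matrix.isUnit_det_transpose_mul_self_of_submatrix {m n : Type*} [Fintype m] [Fintype n]
    [DecidableEq n] {M : Matrix m n ℝ} (f : n → m) (h : (M.submatrix f id).det ≠ 0) :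
    IsUnit (Mᵀ * M).det := by
  have := isUnit_det_self_mul_transpose_of_submatrix (M := Mᵀ) f (by
    rw [← det_transpose] at h
    exact h)
  rwa [transpose_transpose] at this

section GaussianMatrix

variable {n p : ℕ} {S : Matrix (Fin n × Fin p) (Fin n × Fin p) ℝ}

/-- One nonvanishing maximal minor suffices. The leading minor is the determinant of a linear image
of `y`, and the witness is a matrix whose leading block is the identity. -/
theorem ae_isUnit_self_mul_transpose (hS : S.PosDef) (h : n ≤ p) :
    ∀ᵐ y ∂multivariateGaussian 0 S, IsUnit (matOfRows n p y * (matOfRows n p y)ᵀ).det := by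
  set L : EuclideanSpace ℝ (Fin n × Fin p) →ₗ[ℝ] Matrix (Fin n) (Fin n) ℝ :=
    { toFun := fun y => (matOfRows n p y).submatrix id (Fin.castLE h)
      map_add' := fun _ _ => rfl
      map_smul' := fun _ _ => rfl }
  have hw : (L (WithLp.toLp 2 fun k => if Fin.castLE h k.1 = k.2 then 1 else 0)).det ≠ 0 := by
    have : L (WithLp.toLp 2 fun k => if Fin.castLE h k.1 = k.2 then 1 else 0) = 1 := by
      ext i j
      change (if Fin.castLE h i = Fin.castLE h j then (1 : ℝ) else 0) = _
      simp [one_apply]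
    simp [this]
  filter_upwards [ae_det_ne_zero_multivariateGaussian hS L hw] with y hy
  exact isUnit_det_self_mul_transpose_of_submatrix _ hy

theorem ae_isUnit_transpose_mul_self (hS : S.PosDef) (h : p ≤ n) :
    ∀ᵐ y ∂multivariateGaussian 0 S, IsUnit ((matOfRows n p y)ᵀ * matOfRows n p y).det := by
  set L : EuclideanSpace ℝ (Fin n × Fin p) →ₗ[ℝ] Matrix (Fin p) (Fin p) ℝ :=
    { toFun := fun y => (matOfRows n p y).submatrix (Fin.castLE h) id
      map_add' := fun _ _ => rfl
      map_smul' := fun _ _ => rfl }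
  have hw : (L (WithLp.toLp 2 fun k => if k.1 = Fin.castLE h k.2 then 1 else 0)).det ≠ 0 := by
    have : L (WithLp.toLp 2 fun k => if k.1 = Fin.castLE h k.2 then 1 else 0) = 1 := by
      ext i j
      change (if Fin.castLE h i = Fin.castLE h j then (1 : ℝ) else 0) = _
      simp [one_apply]
    simp [this]
  filter_upwards [ae_det_ne_zero_multivariateGaussian hS L hw] with y hy
  exact isUnit_det_transpose_mul_self_of_submatrix _ hy

theorem measurable_inv_apply {V k : Type*} [TopologicalSpace V] [MeasurableSpace V]
    [OpensMeasurableSpace V] [Fintype k] [DecidableEq k] {M : V → Matrix k k ℝ}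
    (hM : Continuous M) (i j : k) : Measurable fun y => (M y)⁻¹ i j := by
  simp only [inv_def, Matrix.smul_apply, Ring.inverse_eq_inv', smul_eq_mul]
  exact hM.matrix_det.measurable.inv.mul (hM.matrix_adjugate.matrix_elem i j).measurable

theorem measurable_matrix_mul_apply {V l m k : Type*} [MeasurableSpace V] [Fintype m]
    {M : V → Matrix l m ℝ} {N : V → Matrix m k ℝ} (hM : ∀ i j, Measurable fun y => M y i j)
    (hN : ∀ i j, Measurable fun y => N y i j) (i : l) (j : k) :
    Measurable fun y => (M y * N y) i j := by
  simp only [mul_apply]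
  exact Finset.measurable_sum _ fun a _ => (hM i a).mul (hN a j)

/-- The pseudoinverse is defined by choice, so measurability is obtained through an explicit formula
`N` that agrees with it almost everywhere. The two cases `n ≤ p` and `p ≤ n` are merged here. -/
theorem exists_pinv_matOfRows_ae_eq (hS : S.PosDef) {A : Matrix (Fin p) (Fin p) ℝ}
    (hA : IsUnit A.det) :
    ∃ N : EuclideanSpace ℝ (Fin n × Fin p) → Matrix (Fin p) (Fin n) ℝ,
      (∀ i j, Measurable fun y => N y i j) ∧
      ∀ᵐ y ∂multivariateGaussian 0 S, pinv (matOfRows n p y) = N y ∧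
        min n p ≤ (matOfRows n p y).rank ∧
        ∀ (x : Fin p → ℝ) (v : Fin p × Fin n → ℝ), unvec v * A = matOfRows n p y →
          ∃ u', HasPinvTraces A x (min n p) v ((pinv (unvec v * A))ᵀ *ᵥ x) u' := by
  have hc := continuous_matOfRows n p
  have hm : ∀ i j, Measurable fun y => matOfRows n p y i j := fun i j =>
    (hc.matrix_elem i j).measurable
  rcases le_total n p with h | h
  · refine ⟨fun y => (matOfRows n p y)ᵀ * (matOfRows n p y * (matOfRows n p y)ᵀ)⁻¹,
      measurable_matrix_mul_apply (M := fun y => (matOfRows n p y)ᵀ) (fun i j => hm j i)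
        (measurable_inv_apply (hc.matrix_mul hc.matrix_transpose)), ?_⟩
    rw [min_eq_left h]
    filter_upwards [ae_isUnit_self_mul_transpose hS h] with y hy
    refine ⟨pinv_of_isUnit_self_mul_transpose hy, ?_, fun x v hv => ?_⟩
    · have h1 := rank_of_isUnit _ ((isUnit_iff_isUnit_det _).2 hy)
      rw [Fintype.card_fin] at h1
      exact h1.symm.le.trans (rank_mul_le_left _ _)
    · exact exists_hasPinvTraces_of_isUnit_self_mul_transpose (hv ▸ hy)
  · refine ⟨fun y => ((matOfRows n p y)ᵀ * matOfRows n p y)⁻¹ * (matOfRows n p y)ᵀ,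
      measurable_matrix_mul_apply (N := fun y => (matOfRows n p y)ᵀ)
        (measurable_inv_apply (hc.matrix_transpose.matrix_mul hc)) (fun i j => hm j i), ?_⟩
    rw [min_eq_right h]
    filter_upwards [ae_isUnit_transpose_mul_self hS h] with y hy
    refine ⟨pinv_of_isUnit_transpose_mul_self hy, ?_, fun x v hv => ?_⟩
    · have h1 := rank_of_isUnit _ ((isUnit_iff_isUnit_det _).2 hy)
      rw [Fintype.card_fin] at h1
      exact h1.symm.le.trans (rank_mul_le_right _ _)
    · exact exists_hasPinvTraces_of_isUnit_transpose_mul_self hA (hv ▸ hy)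

/-! ### Integrability of `1 / F` -/

theorem ENNReal.inv_le_mul_inv_of_le_mul {s c t : ENNReal} (hc0 : c ≠ 0) (hc : c ≠ ⊤)
    (h : s ≤ c * t) : t⁻¹ ≤ c * s⁻¹ := by
  calc t⁻¹ = c * (c⁻¹ * t⁻¹) := by rw [← mul_assoc, ENNReal.mul_inv_cancel hc0 hc, one_mul]
    _ = c * (c * t)⁻¹ := by rw [ENNReal.mul_inv (Or.inl hc0) (Or.inl hc)]
    _ ≤ c * s⁻¹ := by gcongr

theorem statF_transpose_mul_self_nonneg (x : Fin p → ℝ) (M : Matrix (Fin n) (Fin p) ℝ) :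
    0 ≤ statF x (Mᵀ * M) := by
  rw [statF_transpose_mul_self]
  exact Finset.sum_nonneg fun i _ => mul_self_nonneg _

theorem CFC.isUnit_det_sqrt_of_posDef {k : Type*} [Fintype k] [DecidableEq k] {T : Matrix k k ℝ}
    (hT : T.PosDef) : IsUnit (CFC.sqrt T).det :=
  (isUnit_iff_isUnit_det _).1 ((CFC.isUnit_sqrt_iff T hT.posSemidef.nonneg).2 hT.isUnit)

theorem CFC.transpose_sqrt {k : Type*} [Fintype k] [DecidableEq k] (T : Matrix k k ℝ) :
    (CFC.sqrt T)ᵀ = CFC.sqrt T := by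
  have h := (CFC.sqrt_nonneg T).isSelfAdjoint
  rwa [IsSelfAdjoint, star_eq_conjTranspose, conjTranspose_eq_transpose_of_trivial] at h

/-- The Gaussian is the law of `A (g + a)` with `g` standard and `a = A⁻¹ θ`. The directions `qᵢ`
depend on `M`, so a constant `K` free of `M` needs the moment bound to be uniform in them. -/
theorem exists_lintegral_inv_statF_le (θ : EuclideanSpace ℝ (Fin p))
    {T : Matrix (Fin p) (Fin p) ℝ} (hT : T.PosDef) :
    ∃ K : ENNReal, K ≠ ⊤ ∧ ∀ M : Matrix (Fin n) (Fin p) ℝ, 3 ≤ M.rank →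
      ∫⁻ x, (ENNReal.ofReal (statF (WithLp.ofLp x) (Mᵀ * M)))⁻¹ ∂multivariateGaussian θ T ≤
        ENNReal.ofReal ((∑ i, ∑ j, (M * (CFC.sqrt T)⁻¹) i j ^ 2) + 1) * K := by
  set A := CFC.sqrt T with hA
  have hAu : IsUnit A.det := CFC.isUnit_det_sqrt_of_posDef hT
  obtain ⟨K, hK, hle⟩ := exists_lintegral_inv_sum_sq_inner_stdGaussian_le
    (EuclideanSpace ℝ (Fin p))
  refine ⟨K, hK, fun M hM => ?_⟩
  have hZA : M * A⁻¹ * A = M := by rw [Matrix.mul_assoc, nonsing_inv_mul _ hAu, Matrix.mul_one]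
  obtain ⟨q, hq, hqF⟩ := exists_orthonormal_sum_inner_sq_le_mul_statF (k := 3) hAu
    (CFC.transpose_sqrt T) (Z := M * A⁻¹) (by rwa [hZA])
  rw [hZA] at hqF
  set c : ℝ := ∑ i, ∑ j, (M * A⁻¹) i j ^ 2 with hc
  have hc0 : 0 ≤ c := Finset.sum_nonneg fun i _ => Finset.sum_nonneg fun j _ => sq_nonneg _
  set a : EuclideanSpace ℝ (Fin p) := WithLp.toLp 2 (A⁻¹ *ᵥ WithLp.ofLp θ) with ha
  have hshift : ∀ g : EuclideanSpace ℝ (Fin p),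
      WithLp.ofLp (θ + toEuclideanCLM (𝕜 := ℝ) A g) = A *ᵥ WithLp.ofLp (g + a) := by
    intro g
    rw [WithLp.ofLp_add, WithLp.ofLp_add, ofLp_toEuclideanCLM, mulVec_add, ha, mulVec_mulVec,
      mul_nonsing_inv _ hAu, one_mulVec, add_comm]
  have hmeas : Measurable fun x : EuclideanSpace ℝ (Fin p) =>
      (ENNReal.ofReal (statF (WithLp.ofLp x) (Mᵀ * M)))⁻¹ := by
    have : Continuous fun x : EuclideanSpace ℝ (Fin p) => statF (WithLp.ofLp x) (Mᵀ * M) := by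
      unfold statF
      fun_prop
    exact this.measurable.ennreal_ofReal.inv
  rw [multivariateGaussian, lintegral_map hmeas (by fun_prop)]
  calc ∫⁻ g, (ENNReal.ofReal (statF (WithLp.ofLp (θ + toEuclideanCLM (𝕜 := ℝ) A g))
          (Mᵀ * M)))⁻¹ ∂stdGaussian (EuclideanSpace ℝ (Fin p))
      ≤ ∫⁻ g, ENNReal.ofReal (c + 1) * (∑ i, ‖inner ℝ (q i) (g + a)‖ₑ ^ 2)⁻¹
          ∂stdGaussian (EuclideanSpace ℝ (Fin p)) := by
        -- The added 1 keeps the constant nonzero, as inversion in `ENNReal` requires.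
        refine lintegral_mono fun g => ENNReal.inv_le_mul_inv_of_le_mul
          (by simp; positivity) ENNReal.ofReal_ne_top ?_
        rw [hshift, ← ENNReal.ofReal_mul (by positivity)]
        have h1 : ∑ i, ‖inner ℝ (q i) (g + a)‖ₑ ^ 2 =
            ENNReal.ofReal (∑ i, inner ℝ (q i) (g + a) ^ 2) := by
          rw [ENNReal.ofReal_sum_of_nonneg fun i _ => sq_nonneg _]
          refine Finset.sum_congr rfl fun i _ => ?_
          rw [← ofReal_norm, ← ENNReal.ofReal_pow (norm_nonneg _), Real.norm_eq_abs, sq_abs]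
        rw [h1]
        refine ENNReal.ofReal_le_ofReal ((hqF (g + a)).trans ?_)
        exact mul_le_mul_of_nonneg_right (by linarith) (statF_transpose_mul_self_nonneg _ _)
    _ ≤ ENNReal.ofReal (c + 1) * K := by
        rw [lintegral_const_mul _ (by fun_prop)]
        gcongr
        exact hle q hq a

theorem integrable_sum_sq_matOfRows_mul (B : Matrix (Fin p) (Fin p) ℝ) :
    Integrable (fun y => ∑ i, ∑ j, (matOfRows n p y * B) i j ^ 2) (multivariateGaussian 0 S) := by
  refine integrable_finsetSum _ fun i _ => integrable_finsetSum _ fun j _ => ?_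
  set ℓ : EuclideanSpace ℝ (Fin n × Fin p) →ₗ[ℝ] ℝ :=
    { toFun := fun y => (matOfRows n p y * B) i j
      map_add' := fun y z => by rw [map_add, Matrix.add_mul]; rfl
      map_smul' := fun a y => by rw [map_smul, Matrix.smul_mul]; rfl }
  have h := (ℓ.toContinuousLinearMap).comp_memLp' (IsGaussian.memLp_two_id
    (μ := multivariateGaussian (0 : EuclideanSpace ℝ (Fin n × Fin p)) S))
  exact h.integrable_sq

theorem aemeasurable_statF_matOfRows (hS : S.PosDef) (θ : EuclideanSpace ℝ (Fin p))
    {T : Matrix (Fin p) (Fin p) ℝ} :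
    AEMeasurable (fun z : EuclideanSpace ℝ (Fin p) × EuclideanSpace ℝ (Fin n × Fin p) =>
      statF (WithLp.ofLp z.1) ((matOfRows n p z.2)ᵀ * matOfRows n p z.2))
      ((multivariateGaussian θ T).prod (multivariateGaussian 0 S)) := by
  obtain ⟨N, hN, hae⟩ := exists_pinv_matOfRows_ae_eq (n := n) hS
    (A := (1 : Matrix (Fin p) (Fin p) ℝ)) (by simp)
  refine ⟨fun z => ((N z.2)ᵀ *ᵥ WithLp.ofLp z.1) ⬝ᵥ ((N z.2)ᵀ *ᵥ WithLp.ofLp z.1), ?_, ?_⟩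
  · have h : ∀ i, Measurable fun z : EuclideanSpace ℝ (Fin p) ×
        EuclideanSpace ℝ (Fin n × Fin p) => ((N z.2)ᵀ *ᵥ WithLp.ofLp z.1) i := by
      intro i
      simp only [mulVec, _root_.dotProduct, transpose_apply]
      exact Finset.measurable_sum _ fun j _ => ((hN j i).comp measurable_snd).mul (by fun_prop)
    simp only [_root_.dotProduct]
    exact Finset.measurable_sum _ fun i _ => (h i).mul (h i)
  · filter_upwards [Measure.quasiMeasurePreserving_snd.ae hae] with z hz
    rw [statF_transpose_mul_self, hz.1]

theorem lintegral_inv_statF_lt_top (hS : S.PosDef) (hnp : 3 ≤ min n p)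
    (θ : EuclideanSpace ℝ (Fin p)) {T : Matrix (Fin p) (Fin p) ℝ} (hT : T.PosDef) :
    ∫⁻ z, (ENNReal.ofReal (statF (WithLp.ofLp z.1)
      ((matOfRows n p z.2)ᵀ * matOfRows n p z.2)))⁻¹
        ∂((multivariateGaussian θ T).prod (multivariateGaussian 0 S)) < ⊤ := by
  obtain ⟨K, hK, hle⟩ := exists_lintegral_inv_statF_le (n := n) θ hT
  obtain ⟨_, _, hae⟩ := exists_pinv_matOfRows_ae_eq (n := n) hS
    (A := (1 : Matrix (Fin p) (Fin p) ℝ)) (by simp)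
  rw [lintegral_prod_symm (fun z => (ENNReal.ofReal (statF (WithLp.ofLp z.1)
    ((matOfRows n p z.2)ᵀ * matOfRows n p z.2)))⁻¹)
    (aemeasurable_statF_matOfRows hS θ).ennreal_ofReal.inv]
  have hint : Integrable (fun y => (∑ i, ∑ j, (matOfRows n p y * (CFC.sqrt T)⁻¹) i j ^ 2) + 1)
    (multivariateGaussian 0 S) := (integrable_sum_sq_matOfRows_mul _).add (integrable_const 1)
  calc ∫⁻ y, ∫⁻ x, (ENNReal.ofReal (statF (WithLp.ofLp x)
        ((matOfRows n p y)ᵀ * matOfRows n p y)))⁻¹ ∂multivariateGaussian θ T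
          ∂multivariateGaussian 0 S
      ≤ ∫⁻ y, ENNReal.ofReal ((∑ i, ∑ j, (matOfRows n p y * (CFC.sqrt T)⁻¹) i j ^ 2) + 1) * K
          ∂multivariateGaussian 0 S := by
        refine lintegral_mono_ae ?_
        filter_upwards [hae] with y hy
        exact hle _ (hnp.trans hy.2.1)
    _ = (∫⁻ y, ENNReal.ofReal ((∑ i, ∑ j, (matOfRows n p y * (CFC.sqrt T)⁻¹) i j ^ 2) + 1)
          ∂multivariateGaussian 0 S) * K := lintegral_mul_const' _ _ hK
    _ < ⊤ := ENNReal.mul_lt_top hint.lintegral_lt_top hK.lt_top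

theorem integrable_inv_statF (hS : S.PosDef) (hnp : 3 ≤ min n p)
    (θ : EuclideanSpace ℝ (Fin p)) {T : Matrix (Fin p) (Fin p) ℝ} (hT : T.PosDef) :
    (∀ᵐ z ∂((multivariateGaussian θ T).prod (multivariateGaussian 0 S)),
      statF (WithLp.ofLp z.1) ((matOfRows n p z.2)ᵀ * matOfRows n p z.2) ≠ 0) ∧
    Integrable (fun z => (statF (WithLp.ofLp z.1)
      ((matOfRows n p z.2)ᵀ * matOfRows n p z.2))⁻¹)
      ((multivariateGaussian θ T).prod (multivariateGaussian 0 S)) := by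
  have hm := aemeasurable_statF_matOfRows (n := n) hS θ (T := T)
  have hlt := lintegral_inv_statF_lt_top hS hnp θ hT
  have hne : ∀ᵐ z ∂((multivariateGaussian θ T).prod (multivariateGaussian 0 S)),
      statF (WithLp.ofLp z.1) ((matOfRows n p z.2)ᵀ * matOfRows n p z.2) ≠ 0 := by
    -- The extended inverse equals `⊤` where `F = 0`, so finiteness of its integral already excludes
    -- that set up to measure zero.
    filter_upwards [ae_lt_top' hm.ennreal_ofReal.inv hlt.ne] with z hz h0
    simp [h0] at hz
  refine ⟨hne, hm.inv.aestronglyMeasurable, ?_⟩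
  rw [HasFiniteIntegral]
  refine lt_of_le_of_lt (lintegral_mono_ae ?_) hlt
  filter_upwards [hne] with z hz
  have h0 := statF_transpose_mul_self_nonneg (WithLp.ofLp z.1) (matOfRows n p z.2)
  rw [← ofReal_norm, Real.norm_of_nonneg (inv_nonneg.2 h0),
    ENNReal.ofReal_inv_of_pos (lt_of_le_of_ne h0 hz.symm)]

/-! ### Domination of the divergence and transfer to the probability space -/

theorem ae_differentiableAt_and_integrable_divergence_vecField (hS : S.PosDef)
    (hnp : 3 ≤ min n p) (θ : EuclideanSpace ℝ (Fin p)) {T : Matrix (Fin p) (Fin p) ℝ}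
    (hT : T.PosDef) {r : ℝ → ℝ} {C₁ C₂ : ℝ} (hr : ∀ t, r t ∈ Set.Icc 0 C₁)
    (hrd : Differentiable ℝ r) (hr' : ∀ t, |deriv r t| ≤ C₂) :
    (∀ᵐ z ∂((multivariateGaussian θ T).prod (multivariateGaussian 0 S)),
      DifferentiableAt ℝ (vecField (n := n) r (CFC.sqrt T) (WithLp.ofLp z.1))
        (vec (matOfRows n p z.2 * (CFC.sqrt T)⁻¹))) ∧
    Integrable (fun z => divergence (vecField (n := n) r (CFC.sqrt T) (WithLp.ofLp z.1))
        (vec (matOfRows n p z.2 * (CFC.sqrt T)⁻¹)))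
      ((multivariateGaussian θ T).prod (multivariateGaussian 0 S)) := by
  have hA : IsUnit (CFC.sqrt T).det := CFC.isUnit_det_sqrt_of_posDef hT
  obtain ⟨hne, hint⟩ := integrable_inv_statF hS hnp θ hT
  obtain ⟨_, _, hae⟩ := exists_pinv_matOfRows_ae_eq (n := n) hS hA
  have hm := aemeasurable_statF_matOfRows (n := n) hS θ (T := T)
  set μ := (multivariateGaussian θ T).prod (multivariateGaussian 0 S)
  set F : EuclideanSpace ℝ (Fin p) × EuclideanSpace ℝ (Fin n × Fin p) → ℝ := fun z =>
    statF (WithLp.ofLp z.1) ((matOfRows n p z.2)ᵀ * matOfRows n p z.2) with hF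
  -- This constant equals `|n - p| + 3`.
  set κ : ℝ := n + p - 2 * (min n p : ℕ) + 3 with hκ
  have key : ∀ᵐ z ∂μ, DifferentiableAt ℝ (vecField (n := n) r (CFC.sqrt T) (WithLp.ofLp z.1))
        (vec (matOfRows n p z.2 * (CFC.sqrt T)⁻¹)) ∧
      divergence (vecField (n := n) r (CFC.sqrt T) (WithLp.ofLp z.1))
        (vec (matOfRows n p z.2 * (CFC.sqrt T)⁻¹)) =
          κ * (r (F z) ^ 2 * (F z)⁻¹) - 4 * (r (F z) * deriv r (F z)) := by
    filter_upwards [hne, Measure.quasiMeasurePreserving_snd.ae hae] with z hz hz2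
    have hv : unvec (vec (matOfRows n p z.2 * (CFC.sqrt T)⁻¹)) * CFC.sqrt T =
        matOfRows n p z.2 := by
      change matOfRows n p z.2 * (CFC.sqrt T)⁻¹ * CFC.sqrt T = _
      rw [Matrix.mul_assoc, nonsing_inv_mul _ hA, Matrix.mul_one]
    obtain ⟨u', hu'⟩ := hz2.2.2 (WithLp.ofLp z.1) _ hv
    have := hu'.divergence_vecField hrd hA (by rwa [hv])
    rwa [hv] at this
  refine ⟨key.mono fun z hz => hz.1, ?_⟩
  have hC₁ : 0 ≤ C₁ := (hr 0).1.trans (hr 0).2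
  refine Integrable.congr ?_ (key.mono fun z hz => hz.2.symm)
  refine Integrable.mono' (g := fun z => |κ| * C₁ ^ 2 * (F z)⁻¹ + 4 * (C₁ * C₂))
    ((hint.const_mul _).add (integrable_const _)) ?_ (Filter.Eventually.of_forall fun z => ?_)
  · have h1 : AEMeasurable (fun z => r (F z)) μ := hrd.continuous.measurable.comp_aemeasurable hm
    have h2 : AEMeasurable (fun z => deriv r (F z)) μ := (measurable_deriv r).comp_aemeasurable hm
    exact ((((h1.pow_const 2).mul hm.inv).const_mul κ).sub
      ((h1.mul h2).const_mul 4)).aestronglyMeasurable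
  · have hF0 : 0 ≤ (F z)⁻¹ := inv_nonneg.2 (statF_transpose_mul_self_nonneg _ _)
    have hr0 := (hr (F z)).1
    have hr1 := (hr (F z)).2
    rw [Real.norm_eq_abs]
    refine (abs_sub _ _).trans (add_le_add ?_ ?_)
    · rw [abs_mul, abs_mul, abs_of_nonneg hF0, abs_of_nonneg (sq_nonneg (r (F z))), mul_assoc]
      gcongr
    · rw [abs_mul, abs_mul, abs_of_nonneg hr0, abs_of_pos (by norm_num : (0 : ℝ) < 4)]
      gcongr
      exact hr' _

end GaussianMatrix

theorem mainTheorem1 {Ω : Type*} [MeasurableSpace Ω] (P : Measure Ω) [IsProbabilityMeasure P]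
    (n p : ℕ) (θ : EuclideanSpace ℝ (Fin p)) (Sig : Matrix (Fin p) (Fin p) ℝ)
    (hSig : Sig.PosDef)
    (X : Ω → EuclideanSpace ℝ (Fin p)) (Y : Ω → Matrix (Fin n) (Fin p) ℝ)
    (hX : HasLaw X (multivariateGaussian θ Sig) P)
    (hY : HasLaw (fun ω => WithLp.toLp 2 (vec (Y ω)ᵀ))
      (multivariateGaussian (0 : EuclideanSpace ℝ (Fin n × Fin p))
        ((1 : Matrix (Fin n) (Fin n) ℝ) ⊗ₖ Sig)) P)
    (hXY : IndepFun X (fun ω => WithLp.toLp 2 (vec (Y ω)ᵀ) :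
      Ω → EuclideanSpace ℝ (Fin n × Fin p)) P)
    (r : ℝ → ℝ) (C₁ C₂ : ℝ) (hr : ∀ t, r t ∈ Set.Icc 0 C₁) (hrd : Differentiable ℝ r)
    (hr' : ∀ t, |deriv r t| ≤ C₂)
    (hR : P {ω | 2 < ((Y ω)ᵀ * Y ω).rank} = 1) :
    (∀ᵐ ω ∂P, DifferentiableAt ℝ (vecField (n := n) r (CFC.sqrt Sig) (X ω))
      (vec (Y ω * (CFC.sqrt Sig)⁻¹))) ∧
    Integrable (fun ω => divergence (vecField (n := n) r (CFC.sqrt Sig) (X ω))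
      (vec (Y ω * (CFC.sqrt Sig)⁻¹))) P := by
  have hS : ((1 : Matrix (Fin n) (Fin n) ℝ) ⊗ₖ Sig).PosDef := PosDef.one.kronecker hSig
  -- A single outcome of rank greater than 2 bounds both dimensions from below; full rank almost
  -- surely then follows from Gaussianity.
  have hnp : 3 ≤ min n p := by
    obtain ⟨ω, hω⟩ := nonempty_of_measure_ne_zero (μ := P)
      (s := {ω | 2 < ((Y ω)ᵀ * Y ω).rank}) (by rw [hR]; exact one_ne_zero)
    have h1 : 2 < (Y ω).rank := lt_of_lt_of_le hω (rank_mul_le_right _ _)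
    have h2 := (Y ω).rank_le_height
    have h3 := (Y ω).rank_le_width
    exact le_min (by omega) (by omega)
  have hlaw := (indepFun_iff_hasLaw_prodMk_prod hX hY).1 hXY
  obtain ⟨h1, h2⟩ := ae_differentiableAt_and_integrable_divergence_vecField hS hnp θ hSig hr hrd hr'
  rw [← hlaw.map_eq] at h1 h2
  exact ⟨ae_of_ae_map hlaw.aemeasurable h1, h2.comp_aemeasurable hlaw.aemeasurable⟩
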